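/- Let $a>0$, and let $\mathbb F_a$ be the set of all measures $\alpha$ on $(\mathbb R,\mathcal B(\mathbb R))$ with $\alpha(\mathbb R)=a$ and $\int_{\mathbb R}\log(1+|x|)\,\alpha(dx)<+\infty$. For $\alpha\in\mathbb F_a$ let $\mathcal D_\alpha$ be the functional Dirichlet distribution with parameter $\alpha$, that is, the probability law on the space of probability measures $\varphi$ on $\mathbb R$ such that, for every finite measurable partition $C_1,\dots,C_n$ of $\mathbb R$, the vector $(\varphi(C_1),\dots,\varphi(C_n))$ has under $\mathcal D_\alpha$ the Dirichlet distribution with parameter $(\alpha(C_1),\dots,\alpha(C_n))$ (coordinates whose parameter is $0$ being almost surely $0$). Then, for every $\alpha\in\mathbb F_a$, the law $\mathcal D_\alpha$ exists and is unique, and $\int|x|\,\varphi(dx)<+\infty$ for $\mathcal D_\alpha$-almost every $\varphi$; hence the law $\mu_\alpha$ of the mean $\int x\,\varphi(dx)$ under $\mathcal D_\alpha$ is well defined. Any $\alpha\in\mathbb F_a$ is determined by its $\mu_\alpha$: if $\alpha_1,\alpha_2\in\mathbb F_a$ and $\mu_{\alpha_1}=\mu_{\alpha_2}$, then $\alpha_1=\alpha_2$.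 Consequently $\alpha\mapsto\mu_\alpha$ is a bijection of $\mathbb F_a$ onto $\mathbb M_a:=\{\mu_\alpha:\alpha\in\mathbb F_a\}$. -/

import Mathlib

open MeasureTheory ProbabilityTheory Set

noncomputable section

/-- The gamma distribution with shape `b ≥ 0` and scale `1`, where shape `0` means the unit
mass at `0`. -/
def gammaLaw (b : ℝ) : Measure ℝ :=
  if b = 0 then Measure.dirac 0 else gammaMeasure b 1

/-- The Dirichlet distribution with parameter `b` (entries `b i ≥ 0`, not all zero): the law of
`(Z i / ∑ j, Z j)` for independent `Z i` that are gamma distributed with shape `b i` and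
scale `1`. Coordinates with `b i = 0` vanish almost surely; if all `b i > 0`, it is the law on
the simplex with density proportional to `∏ i, u i ^ (b i - 1)`. -/
def dirichletDistribution {n : ℕ} (b : Fin n → ℝ) : Measure (Fin n → ℝ) :=
  (Measure.pi fun i => gammaLaw (b i)).map fun z i => z i / ∑ j, z j

/-- `D` is a functional Dirichlet distribution with parameter `α`: a probability law on the space
of probability measures `φ` on `ℝ` (whose σ-algebra, generated by the evaluations `φ ↦ φ B`, is
the Borel σ-algebra of the weak topology) such that, for every finite measurable partition
`C 0, …, C (n - 1)` of `ℝ`, the vector `(φ (C 0), …, φ (C (n - 1)))` has the Dirichlet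
distribution with parameter `(α (C 0), …, α (C (n - 1)))`. -/
structure IsDirichletProcess (α : Measure ℝ) (D : Measure (ProbabilityMeasure ℝ)) : Prop where
  isProbabilityMeasure : IsProbabilityMeasure D
  law_partition : ∀ (n : ℕ) (C : Fin n → Set ℝ), (∀ i, MeasurableSet (C i)) →
    Pairwise (fun i j => Disjoint (C i) (C j)) → ⋃ i, C i = univ →
      D.map (fun (φ : ProbabilityMeasure ℝ) i => (φ : Measure ℝ).real (C i)) =
        dirichletDistribution fun i => α.real (C i)

open Classical in
/-- The functional Dirichlet distribution with parameter `α` (the zero measure when there is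
none). -/
def dirichletProcess (α : Measure ℝ) : Measure (ProbabilityMeasure ℝ) :=
  if h : ∃ D, IsDirichletProcess α D then h.choose else 0

/-- The law `μ_α` of the mean `∫ x φ(dx)`, where `φ` is distributed according to the functional
Dirichlet distribution with parameter `α`. -/
def dirichletMeanLaw (α : Measure ℝ) : Measure ℝ :=
  (dirichletProcess α).map fun φ : ProbabilityMeasure ℝ => ∫ x, x ∂(φ : Measure ℝ)

/-- The set `𝔽_a` of all finite measures `α` on `ℝ` with total mass `a` and
`∫ log (1 + |x|) α(dx) < ∞`. -/
def measuresOfMass (a : ℝ) : Set (Measure ℝ) :=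
  {α | α univ = ENNReal.ofReal a ∧ ∫⁻ x, ENNReal.ofReal (Real.log (1 + |x|)) ∂α < ⊤}

/-- The set `𝕄_a` of all laws of means of Dirichlet processes with parameter in `𝔽_a`. -/
def dirichletMeanLaws (a : ℝ) : Set (Measure ℝ) :=
  {μ | ∃ α ∈ measuresOfMass a, μ = dirichletMeanLaw α}

end

/-! Everything rests on the gamma random measure `ζ` with intensity `α`, characterised by `E exp(-∫
f dζ) = exp(-∫ log(1+f) dα)` for `f` valued in the right half-plane with `log(1+‖f‖)` integrable;
write `L(f)` for the right-hand side. It is built explicitly. If `U` is uniform, `X` has law `α/a`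
and `E` is standard exponential, then `ζ` and `U^(1/a) (ζ + E δ_X)` have the same Laplace
functional: this is the derivative of `u ↦ u L(u^(1/a) f)`, integrated over `[0,1]`
(`integral_gammaLaplace_rpow_mul`). Iterating with independent draws gives a random series of point
masses, with Laplace functional `L` (`IsGammaSample.integral_exp_neg_integral`). Its masses on a
partition are independent gamma variables, so `ζ / ζ(ℝ)` is a Dirichlet process, and the log-moment
condition makes `x` integrable almost surely. Uniqueness holds because the laws on partitions fix
all finite-dimensional laws of the evaluations.

For injectivity, let `S` be the total mass of `ζ` and `M` the mean of `ζ / ζ(ℝ)`. Since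
`log(1+l+z+wx) = log(1+l) + log(1+(z+wx)/(1+l))`, weighting by `e^(-lS)` amounts, up to the factor
`(1+l)^(-a)`, to rescaling `(S, SM)`; the ratio `M` does not see the scale, so `E[e^(-lS); M ∈ A] =
(1+l)^(-a) P(M ∈ A)`. Hence the law of `M` and the number `a` determine the law of `(S, M)`, thus
that of `SM = ∫ x dζ`, thus `L(wx)` for imaginary `w`. Logarithmic differentiation in `w` yields `∫
(1+wx)⁻¹ dα`, which determines `α` (`ext_of_forall_integral_inv_eq`). -/

open scoped ENNReal Topology

/-! ### Estimates for `log (1 + z)` and `(1 + z)⁻¹` on the right half-plane. -/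

lemma norm_log_one_add_le {z : ℂ} (hz : 0 ≤ z.re) :
    ‖Complex.log (1 + z)‖ ≤ Real.log (1 + ‖z‖) + Real.pi := by
  have h1 : 1 ≤ ‖1 + z‖ := by
    have := Complex.re_le_norm (1 + z)
    simp at this; linarith
  have h2 : ‖1 + z‖ ≤ 1 + ‖z‖ := by simpa using norm_add_le (1 : ℂ) z
  refine (Complex.norm_le_abs_re_add_abs_im _).trans ?_
  rw [Complex.log_re, Complex.log_im, abs_of_nonneg (Real.log_nonneg h1)]
  exact add_le_add (Real.log_le_log (by linarith) h2) (Complex.abs_arg_le_pi _)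

lemma log_one_add_re_nonneg {z : ℂ} (hz : 0 ≤ z.re) : 0 ≤ (Complex.log (1 + z)).re := by
  have h1 : 1 ≤ ‖1 + z‖ := by
    have := Complex.re_le_norm (1 + z)
    simp at this; linarith
  rw [Complex.log_re]
  exact Real.log_nonneg h1

lemma one_add_mem_slitPlane {z : ℂ} (hz : 0 ≤ z.re) : 1 + z ∈ Complex.slitPlane := by
  left; simp; linarith

lemma one_add_ne_zero_of_re_nonneg {z : ℂ} (hz : 0 ≤ z.re) : 1 + z ≠ 0 :=
  Complex.slitPlane_ne_zero (one_add_mem_slitPlane hz)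

lemma norm_inv_one_add_le_one {z : ℂ} (hz : 0 ≤ z.re) : ‖(1 + z)⁻¹‖ ≤ 1 := by
  have h1 : 1 ≤ ‖1 + z‖ := by
    have := Complex.re_le_norm (1 + z)
    simp at this; linarith
  rw [norm_inv]
  exact inv_le_one_of_one_le₀ h1

lemma norm_le_norm_one_add {z : ℂ} (hz : 0 ≤ z.re) : ‖z‖ ≤ ‖1 + z‖ := by
  rw [Complex.norm_def, Complex.norm_def]
  apply Real.sqrt_le_sqrt
  simp [Complex.normSq_apply]
  nlinarith

lemma norm_mul_inv_one_add_le_one {z : ℂ} (hz : 0 ≤ z.re) : ‖z * (1 + z)⁻¹‖ ≤ 1 := by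
  rw [norm_mul, norm_inv, ← div_eq_mul_inv]
  exact div_le_one_of_le₀ (norm_le_norm_one_add hz) (norm_nonneg _)

lemma re_real_mul_nonneg {r : ℝ} (hr : 0 ≤ r) {z : ℂ} (hz : 0 ≤ z.re) : 0 ≤ ((r : ℂ) * z).re := by
  simpa using mul_nonneg hr hz

/-! ### Laplace transforms of the gamma and exponential distributions. -/

/-- The exponential factor turns the density into a gamma integral of rate `1 + s`. Allowing
negative `s > -1` gives a neighbourhood of `0`, from which analytic continuation can start. -/
lemma integral_exp_neg_ofReal_mul_gammaMeasure {b : ℝ} (hb : 0 < b) {s : ℝ} (hs : -1 < s) :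
    ∫ x, Complex.exp (-((s : ℂ) * x)) ∂(gammaMeasure b 1) =
      Complex.exp (-(b * Complex.log (1 + s))) := by
  have hG : (Real.Gamma b : ℂ) ≠ 0 := by exact_mod_cast (Real.Gamma_pos_of_pos hb).ne'
  have hs' : 0 < 1 + s := by linarith
  unfold gammaMeasure
  rw [integral_withDensity_eq_integral_toReal_smul (by unfold gammaPDF; fun_prop)
    (by simp [gammaPDF])]
  have h1 : ∀ x : ℝ, (gammaPDF b 1 x).toReal • Complex.exp (-((s : ℂ) * x)) =
      (Ici (0 : ℝ)).indicator (fun x : ℝ => (Real.Gamma b : ℂ)⁻¹ *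
        ((x : ℂ) ^ ((b : ℂ) - 1) * Complex.exp (-(((1 + s : ℝ) : ℂ) * x)))) x := by
    intro x
    rw [gammaPDF, ENNReal.toReal_ofReal (gammaPDFReal_nonneg hb one_pos x), gammaPDFReal]
    by_cases hx : 0 ≤ x
    · rw [if_pos hx, indicator_of_mem (show x ∈ Ici 0 from hx), Complex.real_smul]
      push_cast
      rw [Complex.ofReal_cpow hx]
      push_cast
      rw [show -((1 + (s : ℂ)) * (x : ℂ)) = -(1 * (x : ℂ)) + -(s * x) by ring, Complex.exp_add]
      simp
      ring
    · rw [if_neg hx, indicator_of_notMem (by simpa using hx)]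
      simp
  have harg : (1 + (s : ℂ)).arg ≠ Real.pi := by
    have := Complex.arg_ofReal_of_nonneg hs'.le
    push_cast at this
    rw [this]
    exact Real.pi_pos.ne
  have hne : (1 + (s : ℂ)) ≠ 0 := by exact_mod_cast hs'.ne'
  simp_rw [h1]
  rw [integral_indicator measurableSet_Ici, integral_Ici_eq_integral_Ioi, integral_const_mul,
    Complex.integral_cpow_mul_exp_neg_mul_Ioi (by simpa using hb) hs',
    Complex.Gamma_ofReal, mul_comm, mul_assoc, mul_inv_cancel₀ hG, mul_one,
    one_div]
  push_cast
  rw [Complex.inv_cpow _ _ harg, Complex.cpow_def_of_ne_zero hne, ← Complex.exp_neg, mul_comm]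

lemma Iio_subset_integrableExpSet_gammaMeasure {b : ℝ} (hb : 0 < b) :
    Iio 1 ⊆ integrableExpSet id (gammaMeasure b 1) := by
  intro s hs
  have h := integral_exp_neg_ofReal_mul_gammaMeasure hb (s := -s) (by linarith [mem_Iio.1 hs])
  -- A Bochner integral that is not zero can only come from an integrable function.
  have h2 := (Integrable.of_integral_ne_zero (h ▸ Complex.exp_ne_zero _)).norm
  simpa [integrableExpSet, Complex.norm_exp] using h2

/-- The Laplace transform of the gamma distribution on the right half-plane. -/
lemma integral_exp_neg_mul_gammaMeasure {b : ℝ} (hb : 0 < b) {z : ℂ} (hz : 0 ≤ z.re) :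
    ∫ x, Complex.exp (-(z * x)) ∂(gammaMeasure b 1) = Complex.exp (-(b * Complex.log (1 + z))) := by
  have hU : IsOpen {w : ℂ | -1 < w.re} := isOpen_lt continuous_const Complex.continuous_re
  have hconn : IsPreconnected {w : ℂ | -1 < w.re} := (convex_halfSpace_re_gt (-1)).isPreconnected
  have hint := interior_maximal (Iio_subset_integrableExpSet_gammaMeasure hb) isOpen_Iio
  have hF : AnalyticOnNhd ℂ (fun w => complexMGF id (gammaMeasure b 1) (-w)) {w : ℂ | -1 < w.re} := by
    refine DifferentiableOn.analyticOnNhd (fun w hw => ?_) hU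
    have hw' : (-w).re ∈ interior (integrableExpSet id (gammaMeasure b 1)) :=
      hint (by have h : -1 < w.re := hw; simpa using neg_lt.1 h)
    exact ((hasDerivAt_complexMGF hw').differentiableAt.comp w
      differentiableAt_id.neg).differentiableWithinAt
  have hH : AnalyticOnNhd ℂ (fun w => Complex.exp (-(b * Complex.log (1 + w)))) {w : ℂ | -1 < w.re} := by
    refine DifferentiableOn.analyticOnNhd (fun w hw => ?_) hU
    have : 1 + w ∈ Complex.slitPlane := by
      left
      have : -1 < w.re := hw
      simp; linarith
    exact ((((differentiableAt_id.const_add 1).clog this).const_mul _).neg.cexp).differentiableWithinAt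
  -- Both sides are analytic on `re w > -1` and agree at real points accumulating at `0`; the
  -- identity theorem does the rest.
  have hfreq : ∃ᶠ w in 𝓝[≠] (0 : ℂ), complexMGF id (gammaMeasure b 1) (-w) =
      Complex.exp (-(b * Complex.log (1 + w))) := by
    have htend : Filter.Tendsto (fun s : ℝ => (s : ℂ)) (𝓝[≠] 0) (𝓝[≠] 0) := by
      refine tendsto_nhdsWithin_of_tendsto_nhds_of_eventually_within _ ?_ ?_
      · have := Complex.continuous_ofReal.tendsto (0 : ℝ)
        simpa using this.mono_left nhdsWithin_le_nhds
      · filter_upwards [self_mem_nhdsWithin] with s hs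
        simpa using hs
    refine htend.frequently (Filter.Eventually.frequently ?_)
    filter_upwards [nhdsWithin_le_nhds (Ioi_mem_nhds (show (-1 : ℝ) < 0 by norm_num))] with s hs
    rw [← integral_exp_neg_ofReal_mul_gammaMeasure hb hs]
    simp [complexMGF]
  have := hF.eqOn_of_preconnected_of_frequently_eq hH hconn (by simp) hfreq
    (show z ∈ {w : ℂ | -1 < w.re} from lt_of_lt_of_le (by norm_num) hz)
  simpa [complexMGF] using this

lemma integral_exp_neg_mul_expMeasure {z : ℂ} (hz : 0 ≤ z.re) :
    ∫ x, Complex.exp (-(z * x)) ∂(expMeasure 1) = (1 + z)⁻¹ := by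
  rw [expMeasure, integral_exp_neg_mul_gammaMeasure one_pos hz, Complex.ofReal_one, one_mul,
    Complex.exp_neg, Complex.exp_log (one_add_ne_zero_of_re_nonneg hz)]

/-! ### The Laplace functional and its self-similarity. -/

section Laplace

variable {X : Type*} [MeasurableSpace X]

/-- The Laplace functional `exp (-∫ log (1 + f) dα)` of the gamma random measure with
intensity `α`. -/
noncomputable def gammaLaplace (α : Measure X) (f : X → ℂ) : ℂ :=
  Complex.exp (-∫ x, Complex.log (1 + f x) ∂α)

/-- Test functions of the Laplace functional: measurable functions with values in the right
half-plane such that `log (1 + ‖f‖)` is integrable. -/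
structure IsLaplaceTest (α : Measure X) (f : X → ℂ) : Prop where
  measurable : Measurable f
  re_nonneg : ∀ x, 0 ≤ (f x).re
  integrable : Integrable (fun x => Real.log (1 + ‖f x‖)) α

variable {α : Measure X} {f : X → ℂ}

lemma IsLaplaceTest.integrable_log [IsFiniteMeasure α] (hf : IsLaplaceTest α f) :
    Integrable (fun x => Complex.log (1 + f x)) α :=
  (hf.integrable.add (integrable_const Real.pi)).mono'
    ((hf.measurable.const_add 1).clog.aestronglyMeasurable)
    (ae_of_all _ fun x => norm_log_one_add_le (hf.re_nonneg x))

lemma IsLaplaceTest.real_mul (hf : IsLaplaceTest α f) {r : ℝ} (h0 : 0 ≤ r) (h1 : r ≤ 1) :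
    IsLaplaceTest α fun x => r * f x where
  measurable := hf.measurable.const_mul _
  re_nonneg x := re_real_mul_nonneg h0 (hf.re_nonneg x)
  integrable := by
    have hm := hf.measurable
    refine hf.integrable.mono' (Measurable.aestronglyMeasurable (by fun_prop)) (ae_of_all _ fun x => ?_)
    have hn := norm_nonneg (f x)
    have h2 : ‖(r : ℂ) * f x‖ = r * ‖f x‖ := by simp [abs_of_nonneg h0]
    rw [h2, Real.norm_of_nonneg (Real.log_nonneg (by nlinarith))]
    exact Real.log_le_log (by nlinarith) (by nlinarith)

lemma norm_gammaLaplace_le_one (hf : ∀ x, 0 ≤ (f x).re) : ‖gammaLaplace α f‖ ≤ 1 := by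
  rw [gammaLaplace, Complex.norm_exp, Real.exp_le_one_iff, Complex.neg_re, neg_nonpos]
  by_cases h : Integrable (fun x => Complex.log (1 + f x)) α
  · have := integral_re (𝕜 := ℂ) h
    simp only [RCLike.re_to_complex] at this
    rw [← this]
    exact integral_nonneg fun x => log_one_add_re_nonneg (hf x)
  · rw [integral_undef h]; simp

@[simp] lemma gammaLaplace_zero : gammaLaplace α (fun _ => 0) = 1 := by
  simp [gammaLaplace]

lemma measurable_gammaLaplace_real_mul [SFinite α] (hf : Measurable f) :
    Measurable fun r : ℝ => gammaLaplace α fun x => r * f x := by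
  unfold gammaLaplace
  refine Complex.measurable_exp.comp (Measurable.neg ?_)
  refine (StronglyMeasurable.integral_prod_right (f := fun (r : ℝ) (x : X) =>
    Complex.log (1 + r * f x)) (Measurable.stronglyMeasurable ?_)).measurable
  have : Measurable fun p : ℝ × X => f p.2 := hf.comp measurable_snd
  simp only [Function.uncurry_def]
  fun_prop

lemma continuousOn_gammaLaplace_real_mul [IsFiniteMeasure α] (hf : IsLaplaceTest α f) :
    ContinuousOn (fun r : ℝ => gammaLaplace α fun x => r * f x) (Icc 0 1) := by
  have hm := hf.measurable
  unfold gammaLaplace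
  refine Complex.continuous_exp.comp_continuousOn (ContinuousOn.neg ?_)
  refine continuousOn_of_dominated (bound := fun x => Real.log (1 + ‖f x‖) + Real.pi)
    (fun r _ => Measurable.aestronglyMeasurable (by fun_prop)) ?_
    (hf.integrable.add (integrable_const _)) ?_
  · intro r hr
    refine ae_of_all _ fun x => ?_
    refine (norm_log_one_add_le ((hf.real_mul hr.1 hr.2).re_nonneg x)).trans ?_
    gcongr
    simpa [abs_of_nonneg hr.1] using mul_le_of_le_one_left (norm_nonneg (f x)) hr.2
  · refine ae_of_all _ fun x r hr => ?_
    refine ContinuousAt.continuousWithinAt ?_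
    exact ContinuousAt.clog (by fun_prop) (one_add_mem_slitPlane ((hf.real_mul hr.1 hr.2).re_nonneg x))

/-- The endpoint `r = 0` is excluded: the derivative there would be `∫ f dα`, and only `log (1 +
‖f‖)` is known to be integrable. -/
lemma hasDerivAt_integral_log [IsFiniteMeasure α] (hf : IsLaplaceTest α f) {r : ℝ}
    (hr : r ∈ Ioo (0 : ℝ) 1) :
    HasDerivAt (fun r : ℝ => ∫ x, Complex.log (1 + r * f x) ∂α)
      (∫ x, f x * (1 + r * f x)⁻¹ ∂α) r := by
  have hm := hf.measurable
  have hpos : ∀ s ∈ Ioi (r / 2), ∀ x, 0 ≤ ((s : ℂ) * f x).re := fun s hs x =>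
    re_real_mul_nonneg (by linarith [hr.1, mem_Ioi.1 hs]) (hf.re_nonneg x)
  have hr2 : r / 2 < r := by linarith [hr.1]
  refine (hasDerivAt_integral_of_dominated_loc_of_deriv_le
    (F := fun (s : ℝ) x => Complex.log (1 + s * f x))
    (F' := fun (s : ℝ) x => f x * (1 + s * f x)⁻¹)
    -- From `‖s f / (1 + s f)‖ ≤ 1` the derivative is at most `1 / s`, and `s > r / 2` on the chosen
    -- neighbourhood.
    (bound := fun _ => 2 / r) (Ioi_mem_nhds hr2) ?_ ?_ ?_ ?_ (integrable_const _) ?_).2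
  · exact Filter.Eventually.of_forall fun s => Measurable.aestronglyMeasurable (by fun_prop)
  · exact (hf.real_mul hr.1.le hr.2.le).integrable_log
  · exact Measurable.aestronglyMeasurable (by fun_prop)
  · refine ae_of_all _ fun x s hs => ?_
    have hs0 : 0 < s := by linarith [hr.1, mem_Ioi.1 hs]
    have h := norm_mul_inv_one_add_le_one (hpos s hs x)
    have h2 : ‖(s : ℂ) * f x * (1 + s * f x)⁻¹‖ = s * ‖f x * (1 + s * f x)⁻¹‖ := by
      rw [mul_assoc, norm_mul, Complex.norm_real, Real.norm_of_nonneg hs0.le]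
    rw [h2] at h
    have h3 : ‖f x * (1 + s * f x)⁻¹‖ ≤ 1 / s := by
      rw [le_div_iff₀ hs0]; linarith
    refine h3.trans ?_
    rw [div_le_div_iff₀ hs0 hr.1]
    linarith [mem_Ioi.1 hs]
  · refine ae_of_all _ fun x s hs => ?_
    have h1 : HasDerivAt (fun s : ℝ => 1 + (s : ℂ) * f x) (f x) s := by
      have := ((Complex.ofRealCLM.hasDerivAt (x := s)).mul_const (f x)).const_add 1
      simpa using this
    have := h1.clog_real (one_add_mem_slitPlane (hpos s hs x))
    simpa [div_eq_mul_inv] using this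

lemma stronglyMeasurable_integral_inv_one_add [SFinite α] (hf : Measurable f) :
    StronglyMeasurable fun r : ℝ => ∫ x, (1 + (r : ℂ) * f x)⁻¹ ∂α := by
  refine StronglyMeasurable.integral_prod_right (f := fun (r : ℝ) (x : X) =>
    (1 + (r : ℂ) * f x)⁻¹) (Measurable.stronglyMeasurable ?_)
  have : Measurable fun p : ℝ × X => f p.2 := hf.comp measurable_snd
  simp only [Function.uncurry_def]
  fun_prop

lemma measureReal_univ_of_eq_ofReal {a : ℝ} (ha : 0 < a) (hα : α univ = ENNReal.ofReal a) :
    α.real univ = a := by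
  rw [measureReal_def, hα, ENNReal.toReal_ofReal ha.le]

/-- The integrand is the derivative of `u ↦ u L(w f)` with `w = u^(1/a)`: one has `u dw/du = w / a`,
and `w ∫ f/(1+wf) dα = a - ∫ 1/(1+wf) dα` because `α` has mass `a`, so the terms `L(w f)` cancel. -/
lemma integral_gammaLaplace_rpow_mul [IsFiniteMeasure α] {a : ℝ} (ha : 0 < a)
    (hα : α univ = ENNReal.ofReal a) (hf : IsLaplaceTest α f) :
    ∫ u in Ioc (0 : ℝ) 1, gammaLaplace α (fun x => (u ^ a⁻¹ : ℝ) * f x) *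
      ((a : ℂ)⁻¹ * ∫ x, (1 + (u ^ a⁻¹ : ℝ) * f x)⁻¹ ∂α) = gammaLaplace α f := by
  have hm := hf.measurable
  have hαr : α.real univ = a := measureReal_univ_of_eq_ofReal ha hα
  have haC : (a : ℂ) ≠ 0 := by exact_mod_cast ha.ne'
  have hrange : ∀ u ∈ Icc (0 : ℝ) 1, u ^ a⁻¹ ∈ Icc (0 : ℝ) 1 := fun u hu =>
    ⟨Real.rpow_nonneg hu.1 _, Real.rpow_le_one hu.1 hu.2 (by positivity)⟩
  rw [← intervalIntegral.integral_of_le zero_le_one,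
    intervalIntegral.integral_eq_sub_of_hasDerivAt_of_le
      (f := fun u : ℝ => (u : ℂ) * gammaLaplace α (fun x => (u ^ a⁻¹ : ℝ) * f x)) zero_le_one]
  · simp
  · refine Complex.continuous_ofReal.continuousOn.mul ?_
    refine (continuousOn_gammaLaplace_real_mul hf).comp (f := fun u : ℝ => u ^ a⁻¹) ?_ hrange
    exact (Real.continuous_rpow_const (by positivity)).continuousOn
  · intro u hu
    have hw : u ^ a⁻¹ ∈ Ioo (0 : ℝ) 1 :=
      ⟨Real.rpow_pos_of_pos hu.1 _, Real.rpow_lt_one hu.1.le hu.2 (by positivity)⟩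
    have hd := (hasDerivAt_integral_log hf hw).scomp u
      (Real.hasDerivAt_rpow_const (p := a⁻¹) (Or.inl hu.1.ne'))
    have hd2 := (Complex.ofRealCLM.hasDerivAt (x := u)).mul hd.neg.cexp
    set w := u ^ a⁻¹ with hwdef
    have hre : ∀ x, 0 ≤ ((w : ℂ) * f x).re := (hf.real_mul hw.1.le hw.2.le).re_nonneg
    have hint : Integrable (fun x => (1 + (w : ℂ) * f x)⁻¹) α :=
      (integrable_const (1 : ℝ)).mono' (Measurable.aestronglyMeasurable (by fun_prop))
        (ae_of_all _ fun x => norm_inv_one_add_le_one (hre x))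
    have hsplit : (w : ℂ) * ∫ x, f x * (1 + w * f x)⁻¹ ∂α = a - ∫ x, (1 + w * f x)⁻¹ ∂α := by
      rw [← integral_const_mul, eq_sub_iff_add_eq, ← integral_add ?_ hint]
      · have : ∀ x, (w : ℂ) * (f x * (1 + w * f x)⁻¹) + (1 + w * f x)⁻¹ = 1 := fun x => by
          have := one_add_ne_zero_of_re_nonneg (hre x)
          field_simp
          ring
        simp [this, hαr]
      · refine (integrable_const (1 : ℝ)).mono' (Measurable.aestronglyMeasurable (by fun_prop))
          (ae_of_all _ fun x => ?_)
        rw [← mul_assoc]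
        exact norm_mul_inv_one_add_le_one (hre x)
    refine HasDerivAt.congr_deriv (f := fun u : ℝ => (u : ℂ) * gammaLaplace α
      (fun x => (u ^ a⁻¹ : ℝ) * f x)) hd2 (Eq.symm ?_)
    simp only [Complex.ofRealCLM_apply, Complex.ofReal_one, one_mul, Complex.real_smul,
      gammaLaplace, Pi.neg_apply, Function.comp, ← hwdef]
    have hw' : u ^ (a⁻¹ - 1) = w / u := by rw [Real.rpow_sub_one hu.1.ne']
    have huC : (u : ℂ) ≠ 0 := by exact_mod_cast hu.1.ne'
    rw [hw']
    push_cast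
    rw [eq_sub_iff_add_eq, ← eq_sub_iff_add_eq'] at hsplit
    rw [hsplit]
    field_simp
    ring
  · refine (intervalIntegrable_iff_integrableOn_Ioc_of_le zero_le_one).2 ?_
    have hmu : Measurable fun u : ℝ => u ^ a⁻¹ := by fun_prop
    refine Measure.integrableOn_of_bounded (M := 1) (by simp) ?_ ?_
    · exact (((measurable_gammaLaplace_real_mul hm).comp hmu).mul (measurable_const.mul
        ((stronglyMeasurable_integral_inv_one_add hm).measurable.comp hmu))).aestronglyMeasurable
    · refine (ae_restrict_iff' measurableSet_Ioc).2 (ae_of_all _ fun u hu => ?_)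
      have hw := hrange u ⟨hu.1.le, hu.2⟩
      have hre := (hf.real_mul hw.1 hw.2).re_nonneg
      rw [norm_mul, norm_mul, norm_inv, Complex.norm_real, Real.norm_of_nonneg ha.le]
      have h1 := norm_gammaLaplace_le_one (α := α) hre
      have h2 : ‖∫ x, (1 + ((u ^ a⁻¹ : ℝ) : ℂ) * f x)⁻¹ ∂α‖ ≤ a := by
        refine (norm_integral_le_of_norm_le_const (C := 1)
          (ae_of_all _ fun x => norm_inv_one_add_le_one (hre x))).trans ?_
        rw [hαr, one_mul]
      calc _ ≤ 1 * (a⁻¹ * a) := by gcongr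
        _ = 1 := by field_simp

end Laplace

/-! ### Iterating the self-similarity along independent draws. -/

section Sample

set_option linter.unusedSectionVars false

variable {X : Type*} [MeasurableSpace X]

/-- The joint law of a uniform variable on `(0, 1]`, a point of `X` with distribution `α / a`
and a standard exponential variable, all independent. -/
noncomputable def gammaStep (a : ℝ) (α : Measure X) : Measure (ℝ × X × ℝ) :=
  (volume.restrict (Ioc (0 : ℝ) 1)).prod (((ENNReal.ofReal a)⁻¹ • α).prod (expMeasure 1))

instance : IsProbabilityMeasure (expMeasure 1) := isProbabilityMeasure_expMeasure one_pos

instance : IsProbabilityMeasure (volume.restrict (Ioc (0 : ℝ) 1)) := ⟨by simp⟩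

variable {a : ℝ} {α : Measure X} {f : X → ℂ}

lemma isProbabilityMeasure_inv_smul (ha : 0 < a) (hα : α univ = ENNReal.ofReal a) :
    IsProbabilityMeasure ((ENNReal.ofReal a)⁻¹ • α) :=
  ⟨by rw [Measure.smul_apply, hα, smul_eq_mul, ENNReal.inv_mul_cancel (by simpa using ha) (by simp)]⟩

lemma isProbabilityMeasure_gammaStep (ha : 0 < a) (hα : α univ = ENNReal.ofReal a) :
    IsProbabilityMeasure (gammaStep a α) := by
  have := isProbabilityMeasure_inv_smul ha hα
  unfold gammaStep
  infer_instance

lemma ae_expMeasure_nonneg : ∀ᵐ e ∂(expMeasure 1), 0 < e := by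
  have h : (expMeasure 1) (Iic 0) = 0 := by
    have := cdf_expMeasure_eq one_pos (0 : ℝ)
    rw [cdf_eq_real] at this
    simpa [measureReal_def, ENNReal.toReal_eq_zero_iff] using this
  rw [ae_iff]
  simpa [Iic_def] using h

lemma ae_gammaStep (ha : 0 < a) (hα : α univ = ENNReal.ofReal a) :
    ∀ᵐ p ∂(gammaStep a α), p.1 ∈ Ioc (0 : ℝ) 1 ∧ 0 < p.2.2 := by
  have := isProbabilityMeasure_inv_smul ha hα
  have h1 : ∀ᵐ p ∂(gammaStep a α), p.1 ∈ Ioc (0 : ℝ) 1 :=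
    Measure.quasiMeasurePreserving_fst.ae (ae_restrict_mem measurableSet_Ioc)
  have h2 : ∀ᵐ p ∂(gammaStep a α), 0 < p.2.2 :=
    (Measure.quasiMeasurePreserving_snd.comp Measure.quasiMeasurePreserving_snd).ae
      ae_expMeasure_nonneg
  exact h1.and h2

lemma norm_exp_neg_le_one {z : ℂ} (hz : 0 ≤ z.re) : ‖Complex.exp (-z)‖ ≤ 1 := by
  simpa [Complex.norm_exp] using hz

lemma rpow_inv_mem_Ioc (ha : 0 < a) {u : ℝ} (hu : u ∈ Ioc (0 : ℝ) 1) : u ^ a⁻¹ ∈ Ioc (0 : ℝ) 1 :=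
  ⟨Real.rpow_pos_of_pos hu.1 _, Real.rpow_le_one hu.1.le hu.2 (by positivity)⟩

/-- Averaging over the exponential variable turns `exp (-w e f(x))` into `(1 + w f(x))⁻¹`, which
reduces this to `integral_gammaLaplace_rpow_mul`. It expresses that `ζ` and `U^(1/a) (ζ + E δ_X)`
share their Laplace functional. -/
lemma integral_gammaStep [IsFiniteMeasure α] (ha : 0 < a)
    (hα : α univ = ENNReal.ofReal a) (hf : IsLaplaceTest α f) :
    ∫ p, Complex.exp (-((p.1 ^ a⁻¹ * p.2.2 : ℝ) * f p.2.1)) *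
      gammaLaplace α (fun x => (p.1 ^ a⁻¹ : ℝ) * f x) ∂(gammaStep a α) = gammaLaplace α f := by
  have := isProbabilityMeasure_inv_smul ha hα
  have := isProbabilityMeasure_gammaStep ha hα
  have hm := hf.measurable
  have hmL := measurable_gammaLaplace_real_mul (α := α) hm
  have hmu : Measurable fun u : ℝ => u ^ a⁻¹ := by fun_prop
  have hmeas : Measurable fun p : ℝ × X × ℝ => Complex.exp (-((p.1 ^ a⁻¹ * p.2.2 : ℝ) * f p.2.1)) *
      gammaLaplace α (fun x => (p.1 ^ a⁻¹ : ℝ) * f x) := by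
    have h1 : Measurable fun p : ℝ × X × ℝ => gammaLaplace α (fun x => (p.1 ^ a⁻¹ : ℝ) * f x) :=
      hmL.comp (hmu.comp measurable_fst)
    have h2 : Measurable fun p : ℝ × X × ℝ => f p.2.1 := hm.comp (measurable_fst.comp measurable_snd)
    exact Measurable.mul (by fun_prop) h1
  rw [← integral_gammaLaplace_rpow_mul ha hα hf]
  unfold gammaStep at *
  rw [integral_prod]
  · refine setIntegral_congr_fun measurableSet_Ioc fun u hu => ?_
    have hw := rpow_inv_mem_Ioc ha hu
    have hre := (hf.real_mul hw.1.le hw.2).re_nonneg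
    simp only
    rw [integral_mul_const, mul_comm]
    congr 1
    rw [integral_prod]
    · have : ∀ x : X, ∫ e : ℝ, Complex.exp (-((u ^ a⁻¹ * e : ℝ) * f x)) ∂(expMeasure 1) =
          (1 + (u ^ a⁻¹ : ℝ) * f x)⁻¹ := fun x => by
        rw [← integral_exp_neg_mul_expMeasure (hre x)]
        congr with e
        push_cast
        ring_nf
      simp_rw [this]
      rw [integral_smul_measure, ENNReal.toReal_inv, ENNReal.toReal_ofReal ha.le, Complex.real_smul]
      push_cast
      rfl
    · refine (integrable_const (1 : ℝ)).mono' (Measurable.aestronglyMeasurable ?_) ?_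
      · have h2 : Measurable fun p : X × ℝ => f p.1 := hm.comp measurable_fst
        fun_prop
      · filter_upwards [Measure.quasiMeasurePreserving_snd.ae ae_expMeasure_nonneg] with p hp
        refine norm_exp_neg_le_one (re_real_mul_nonneg (mul_nonneg hw.1.le hp.le) (hf.re_nonneg _))
  · refine (integrable_const (1 : ℝ)).mono' hmeas.aestronglyMeasurable ?_
    filter_upwards [ae_gammaStep ha hα] with p hp
    have hw := rpow_inv_mem_Ioc ha hp.1
    rw [norm_mul]
    exact mul_le_one₀ (norm_exp_neg_le_one (re_real_mul_nonneg (mul_nonneg hw.1.le hp.2.le)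
      (hf.re_nonneg _))) (norm_nonneg _) (norm_gammaLaplace_le_one (hf.real_mul hw.1.le hw.2).re_nonneg)

/-- `P` is the law of a sequence of independent variables with law `gammaStep a α`. -/
structure IsGammaSample (a : ℝ) (α : Measure X) (P : Measure (ℕ → ℝ × X × ℝ)) : Prop where
  isProbabilityMeasure : IsProbabilityMeasure P
  indep : iIndepFun (fun (n : ℕ) (s : ℕ → ℝ × X × ℝ) => s n) P
  law : ∀ n, P.map (fun s => s n) = gammaStep a α

lemma exists_isGammaSample (ha : 0 < a) (hα : α univ = ENNReal.ofReal a) :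
    ∃ P, IsGammaSample a α P := by
  have := isProbabilityMeasure_gammaStep ha hα
  refine ⟨Measure.infinitePi fun _ : ℕ => gammaStep a α, inferInstance, ?_, fun n => ?_⟩
  · exact iIndepFun_infinitePi (P := fun _ : ℕ => gammaStep a α) (X := fun _ p => p)
      fun _ => measurable_id
  · exact Measure.infinitePi_map_eval _ n

/-- The product of the first `n` shrinking factors. -/
noncomputable def shrinkage (a : ℝ) (s : ℕ → ℝ × X × ℝ) (n : ℕ) : ℝ :=
  ∏ j ∈ Finset.range n, (s j).1 ^ a⁻¹

/-- The mass of the `k`-th atom of the gamma random measure. -/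
noncomputable def jump (a : ℝ) (s : ℕ → ℝ × X × ℝ) (k : ℕ) : ℝ :=
  shrinkage a s (k + 1) * (s k).2.2

/-- The integral of `f` with respect to the first `n` atoms of the gamma random measure. -/
noncomputable def partialIntegral (a : ℝ) (f : X → ℂ) (s : ℕ → ℝ × X × ℝ) (n : ℕ) : ℂ :=
  ∑ k ∈ Finset.range n, jump a s k * f (s k).2.1

lemma measurable_shrinkage (n : ℕ) : Measurable fun s : ℕ → ℝ × X × ℝ => shrinkage a s n := by
  unfold shrinkage
  fun_prop

lemma measurable_jump (k : ℕ) : Measurable fun s : ℕ → ℝ × X × ℝ => jump a s k := by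
  have := measurable_shrinkage (X := X) (a := a) (k + 1)
  unfold jump
  fun_prop

lemma measurable_partialIntegral (hf : Measurable f) (n : ℕ) :
    Measurable fun s : ℕ → ℝ × X × ℝ => partialIntegral a f s n := by
  unfold partialIntegral
  refine Finset.measurable_fun_sum _ fun k _ => ?_
  have := measurable_jump (X := X) (a := a) k
  exact this.complex_ofReal.mul (hf.comp (by fun_prop))

lemma shrinkage_congr {s t : ℕ → ℝ × X × ℝ} {n : ℕ} (h : ∀ k < n, s k = t k) :
    shrinkage a s n = shrinkage a t n :=
  Finset.prod_congr rfl fun k hk => by rw [h k (Finset.mem_range.1 hk)]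

lemma partialIntegral_congr {s t : ℕ → ℝ × X × ℝ} {n : ℕ} (h : ∀ k < n, s k = t k) :
    partialIntegral a f s n = partialIntegral a f t n := by
  refine Finset.sum_congr rfl fun k hk => ?_
  have hk := Finset.mem_range.1 hk
  rw [jump, jump, shrinkage_congr (fun j hj => h j (by omega)), h k hk]

lemma shrinkage_succ (s : ℕ → ℝ × X × ℝ) (n : ℕ) :
    shrinkage a s (n + 1) = shrinkage a s n * (s n).1 ^ a⁻¹ := Finset.prod_range_succ _ _

lemma partialIntegral_succ (s : ℕ → ℝ × X × ℝ) (n : ℕ) :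
    partialIntegral a f s (n + 1) = partialIntegral a f s n + jump a s n * f (s n).2.1 :=
  Finset.sum_range_succ _ _

variable {P : Measure (ℕ → ℝ × X × ℝ)}

lemma IsGammaSample.ae_mem (hP : IsGammaSample a α P) (ha : 0 < a)
    (hα : α univ = ENNReal.ofReal a) :
    ∀ᵐ s ∂P, ∀ k, (s k).1 ∈ Ioc (0 : ℝ) 1 ∧ 0 < (s k).2.2 := by
  refine ae_all_iff.2 fun k => ?_
  have h := ae_gammaStep ha hα
  rw [← hP.law k] at h
  exact ae_of_ae_map (measurable_pi_apply k).aemeasurable h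

lemma shrinkage_mem_Ioc (ha : 0 < a) {s : ℕ → ℝ × X × ℝ}
    (hs : ∀ k, (s k).1 ∈ Ioc (0 : ℝ) 1 ∧ 0 < (s k).2.2) (n : ℕ) :
    shrinkage a s n ∈ Ioc (0 : ℝ) 1 := by
  have h := fun k => rpow_inv_mem_Ioc ha (hs k).1
  exact ⟨Finset.prod_pos fun k _ => (h k).1,
    Finset.prod_le_one (fun k _ => (h k).1.le) fun k _ => (h k).2⟩

lemma jump_pos (ha : 0 < a) {s : ℕ → ℝ × X × ℝ}
    (hs : ∀ k, (s k).1 ∈ Ioc (0 : ℝ) 1 ∧ 0 < (s k).2.2) (k : ℕ) : 0 < jump a s k :=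
  mul_pos (shrinkage_mem_Ioc ha hs _).1 (hs k).2

lemma partialIntegral_re_nonneg (ha : 0 < a) (hf : ∀ x, 0 ≤ (f x).re) {s : ℕ → ℝ × X × ℝ}
    (hs : ∀ k, (s k).1 ∈ Ioc (0 : ℝ) 1 ∧ 0 < (s k).2.2) (n : ℕ) :
    0 ≤ (partialIntegral a f s n).re := by
  unfold partialIntegral
  rw [Complex.re_sum]
  exact Finset.sum_nonneg fun k _ => re_real_mul_nonneg (jump_pos ha hs k).le (hf _)

/-- A measurable function of the first `n` coordinates is independent of the `n`-th one. -/
lemma IsGammaSample.indepFun_of_congr [Inhabited X] (hP : IsGammaSample a α P) {β : Type*}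
    [MeasurableSpace β] {F : (ℕ → ℝ × X × ℝ) → β} (hF : Measurable F) {n : ℕ}
    (hFc : ∀ s t : ℕ → ℝ × X × ℝ, (∀ k < n, s k = t k) → F s = F t) :
    IndepFun F (fun s => s n) P := by
  have h := hP.indep.indepFun_finset (Finset.range n) {n} (by simp) fun i => measurable_pi_apply i
  -- The first `n` coordinates are padded with arbitrary values, which `F` ignores.
  let ext : (Finset.range n → ℝ × X × ℝ) → ℕ → ℝ × X × ℝ := fun t k =>
    if h : k ∈ Finset.range n then t ⟨k, h⟩ else (0, default, 0)
  have hext : Measurable ext := by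
    refine measurable_pi_lambda _ fun k => ?_
    by_cases h : k ∈ Finset.range n
    · simp only [ext, dif_pos h]
      exact measurable_pi_apply (X := fun _ : Finset.range n => ℝ × X × ℝ) ⟨k, h⟩
    · simp only [ext, dif_neg h]
      exact measurable_const
  have h2 := h.comp (hF.comp hext)
    (measurable_pi_apply (X := fun _ : ({n} : Finset ℕ) => ℝ × X × ℝ) ⟨n, by simp⟩)
  convert h2 using 1
  · funext s
    refine hFc _ _ fun k hk => ?_
    simp [ext, hk]
  · rfl

/-- The `n`-th draw is independent of the partial integral and the shrinkage up to `n`. With these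
frozen, integrating out the draw is `integral_gammaStep` for the test function `shrinkage a s n *
f`. -/
lemma IsGammaSample.integral_succ [Inhabited X] [IsFiniteMeasure α] (hP : IsGammaSample a α P)
    (ha : 0 < a) (hα : α univ = ENNReal.ofReal a) (hf : IsLaplaceTest α f) (n : ℕ) :
    ∫ s, Complex.exp (-partialIntegral a f s (n + 1)) *
        gammaLaplace α (fun x => (shrinkage a s (n + 1)) * f x) ∂P =
      ∫ s, Complex.exp (-partialIntegral a f s n) *
        gammaLaplace α (fun x => (shrinkage a s n) * f x) ∂P := by
  have := hP.isProbabilityMeasure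
  have := isProbabilityMeasure_gammaStep ha hα
  have hm := hf.measurable
  have hmL := measurable_gammaLaplace_real_mul (α := α) hm
  have hmF : Measurable fun s : ℕ → ℝ × X × ℝ => (partialIntegral a f s n, shrinkage a s n) :=
    (measurable_partialIntegral hm n).prodMk (measurable_shrinkage n)
  have hind := hP.indepFun_of_congr hmF (n := n) fun s t h =>
    Prod.ext (partialIntegral_congr h) (shrinkage_congr h)
  have hlaw := (indepFun_iff_map_prod_eq_prod_map_map hmF.aemeasurable
    (measurable_pi_apply n).aemeasurable).1 hind
  rw [hP.law n] at hlaw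
  -- The integrand at `n + 1` as a function of the past (partial integral, shrinkage) and the new
  -- draw.
  let Ψ : (ℂ × ℝ) × (ℝ × X × ℝ) → ℂ := fun p =>
    Complex.exp (-(p.1.1 + (p.1.2 * p.2.1 ^ a⁻¹ * p.2.2.2 : ℝ) * f p.2.2.1)) *
      gammaLaplace α (fun x => (p.1.2 * p.2.1 ^ a⁻¹ : ℝ) * f x)
  have hΨm : Measurable Ψ := by
    have h1 : Measurable fun p : (ℂ × ℝ) × (ℝ × X × ℝ) =>
        gammaLaplace α (fun x => (p.1.2 * p.2.1 ^ a⁻¹ : ℝ) * f x) := hmL.comp (by fun_prop)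
    have h2 : Measurable fun p : (ℂ × ℝ) × (ℝ × X × ℝ) => f p.2.2.1 := hm.comp (by fun_prop)
    exact Measurable.mul (by fun_prop) h1
  have hmap : Measurable fun s : ℕ → ℝ × X × ℝ =>
      ((partialIntegral a f s n, shrinkage a s n), s n) := hmF.prodMk (measurable_pi_apply n)
  have hΨs : ∀ s : ℕ → ℝ × X × ℝ, Complex.exp (-partialIntegral a f s (n + 1)) *
        gammaLaplace α (fun x => (shrinkage a s (n + 1)) * f x) =
      Ψ ((partialIntegral a f s n, shrinkage a s n), s n) := fun s => by
    simp only [Ψ, partialIntegral_succ, shrinkage_succ, jump]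
  have hint : Integrable Ψ (P.map fun s => ((partialIntegral a f s n, shrinkage a s n), s n)) := by
    rw [integrable_map_measure hΨm.aestronglyMeasurable hmap.aemeasurable]
    refine (integrable_const (1 : ℝ)).mono' (hΨm.comp hmap).aestronglyMeasurable ?_
    filter_upwards [hP.ae_mem ha hα] with s hs
    rw [Function.comp, ← hΨs, norm_mul]
    have hR := shrinkage_mem_Ioc ha hs (n + 1)
    exact mul_le_one₀ (norm_exp_neg_le_one (partialIntegral_re_nonneg ha hf.re_nonneg hs _))
      (norm_nonneg _) (norm_gammaLaplace_le_one (hf.real_mul hR.1.le hR.2).re_nonneg)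
  simp_rw [hΨs]
  rw [← integral_map hmap.aemeasurable hΨm.aestronglyMeasurable, hlaw, integral_prod _ (hlaw ▸ hint),
    integral_map hmF.aemeasurable
      (hΨm.stronglyMeasurable.integral_prod_right').aestronglyMeasurable]
  refine integral_congr_ae ?_
  filter_upwards [hP.ae_mem ha hα] with s hs
  have hR := shrinkage_mem_Ioc ha hs n
  rw [← integral_gammaStep ha hα (hf.real_mul hR.1.le hR.2), ← integral_const_mul]
  congr with p
  simp only [Ψ]
  rw [neg_add, Complex.exp_add, mul_assoc]
  push_cast
  congr 3
  · ring_nf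
  · funext x
    ring

lemma IsGammaSample.integral_partialIntegral [Inhabited X] [IsFiniteMeasure α]
    (hP : IsGammaSample a α P) (ha : 0 < a) (hα : α univ = ENNReal.ofReal a)
    (hf : IsLaplaceTest α f) (n : ℕ) :
    ∫ s, Complex.exp (-partialIntegral a f s n) *
        gammaLaplace α (fun x => (shrinkage a s n) * f x) ∂P = gammaLaplace α f := by
  have := hP.isProbabilityMeasure
  induction n with
  | zero => simp [partialIntegral, shrinkage]
  | succ n ih => rw [hP.integral_succ ha hα hf n, ih]

end Sample

/-! ### Convergence of the series to the gamma random measure. -/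

section GammaProcess

set_option linter.unusedSectionVars false

variable {X : Type*} [MeasurableSpace X] {a : ℝ} {α : Measure X} {f : X → ℂ}
  {P : Measure (ℕ → ℝ × X × ℝ)}

lemma lintegral_gammaStep_rpow (ha : 0 < a) (hα : α univ = ENNReal.ofReal a) :
    ∫⁻ p, ENNReal.ofReal (p.1 ^ a⁻¹) ∂(gammaStep a α) = ENNReal.ofReal (1 / (a⁻¹ + 1)) := by
  have := isProbabilityMeasure_inv_smul ha hα
  have hm : Measurable fun u : ℝ => ENNReal.ofReal (u ^ a⁻¹) := by fun_prop
  rw [gammaStep, lintegral_prod _ (by fun_prop)]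
  simp only [lintegral_const, measure_univ, mul_one]
  have hint : IntegrableOn (fun u : ℝ => u ^ a⁻¹) (Ioc 0 1) :=
    (intervalIntegrable_iff_integrableOn_Ioc_of_le zero_le_one).1
      (intervalIntegral.intervalIntegrable_rpow' (lt_trans (by norm_num) (inv_pos.2 ha)))
  rw [← ofReal_integral_eq_lintegral_ofReal hint, ← intervalIntegral.integral_of_le zero_le_one,
    integral_rpow (Or.inl (lt_trans (by norm_num) (inv_pos.2 ha)))]
  · rw [Real.one_rpow, Real.zero_rpow (by positivity), sub_zero]
  · filter_upwards [ae_restrict_mem measurableSet_Ioc] with u hu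
    exact Real.rpow_nonneg hu.1.le _

lemma IsGammaSample.lintegral_shrinkage [Inhabited X] (hP : IsGammaSample a α P) (ha : 0 < a)
    (hα : α univ = ENNReal.ofReal a) (n : ℕ) :
    ∫⁻ s, ENNReal.ofReal (shrinkage a s n) ∂P = ENNReal.ofReal (1 / (a⁻¹ + 1)) ^ n := by
  have := hP.isProbabilityMeasure
  induction n with
  | zero => simp [shrinkage]
  | succ n ih =>
    have hW : Measurable fun p : ℝ × X × ℝ => ENNReal.ofReal (p.1 ^ a⁻¹) := by fun_prop
    have hind := (hP.indepFun_of_congr (measurable_shrinkage (a := a) n)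
      fun s t h => shrinkage_congr h).comp ENNReal.measurable_ofReal hW
    rw [pow_succ, ← ih, ← lintegral_gammaStep_rpow ha hα, ← hP.law n,
      lintegral_map hW (measurable_pi_apply n)]
    have h2 := lintegral_mul_eq_lintegral_mul_lintegral_of_indepFun
      (ENNReal.measurable_ofReal.comp (measurable_shrinkage n)) (hW.comp (measurable_pi_apply n)) hind
    refine Eq.trans (lintegral_congr_ae ?_) h2
    filter_upwards [hP.ae_mem ha hα] with s hs
    rw [shrinkage_succ, ENNReal.ofReal_mul (shrinkage_mem_Ioc ha hs n).1.le]
    rfl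

/-- The expected shrinkages form a geometric sequence of ratio `1 / (a⁻¹ + 1) < 1`, so the sum of
all shrinkages has finite expectation and its terms tend to `0` almost surely. -/
lemma IsGammaSample.ae_tendsto_shrinkage [Inhabited X] (hP : IsGammaSample a α P) (ha : 0 < a)
    (hα : α univ = ENNReal.ofReal a) :
    ∀ᵐ s ∂P, Filter.Tendsto (shrinkage a s) Filter.atTop (𝓝 0) := by
  have hm : ∀ n, Measurable fun s : ℕ → ℝ × X × ℝ => ENNReal.ofReal (shrinkage a s n) := fun n =>
    (measurable_shrinkage n).ennreal_ofReal
  have hlt : ENNReal.ofReal (1 / (a⁻¹ + 1)) < 1 := by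
    have : 0 < a⁻¹ := inv_pos.2 ha
    rw [ENNReal.ofReal_lt_one, div_lt_one (by linarith)]
    linarith
  have hsum : ∫⁻ s, ∑' n, ENNReal.ofReal (shrinkage a s n) ∂P ≠ ⊤ := by
    rw [lintegral_tsum fun n => (hm n).aemeasurable]
    simp_rw [hP.lintegral_shrinkage ha hα]
    rw [ENNReal.tsum_geometric]
    exact ENNReal.inv_ne_top.2 (tsub_pos_of_lt hlt).ne'
  filter_upwards [ae_lt_top (Measurable.tsum hm) hsum, hP.ae_mem ha hα] with s hs hmem
  have h := ENNReal.tendsto_atTop_zero_of_tsum_ne_top hs.ne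
  have h2 := (ENNReal.tendsto_toReal ENNReal.zero_ne_top).comp h
  refine h2.congr fun n => ?_
  simp [ENNReal.toReal_ofReal (shrinkage_mem_Ioc ha hmem n).1.le]

lemma summable_iff_tsum_ofReal_ne_top {u : ℕ → ℝ} (hu : ∀ k, 0 ≤ u k) :
    Summable u ↔ ∑' k, ENNReal.ofReal (u k) ≠ ⊤ := by
  refine ⟨fun h => h.tsum_ofReal_ne_top, fun h => ?_⟩
  exact (ENNReal.summable_toReal h).congr fun k => ENNReal.toReal_ofReal (hu k)

lemma IsLaplaceTest.of_nonneg {g : X → ℝ} (hg : Measurable g) (h0 : ∀ x, 0 ≤ g x)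
    (hint : Integrable (fun x => Real.log (1 + g x)) α) : IsLaplaceTest α fun x => (g x : ℂ) where
  measurable := hg.complex_ofReal
  re_nonneg x := by simpa using h0 x
  integrable := by simpa [abs_of_nonneg (h0 _)] using hint

/-- Dropping the factor `L(R_n g)`, of norm at most `1`, from the iterated identity gives `‖L(g)‖ ≤
E exp(-S_n)` for the partial sums `S_n`. As `n → ∞` the exponential vanishes where the series
diverges and is at most `1` elsewhere. -/
lemma norm_gammaLaplace_le_measure_summable [Inhabited X] [IsFiniteMeasure α]
    (hP : IsGammaSample a α P) (ha : 0 < a) (hα : α univ = ENNReal.ofReal a)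
    {g : X → ℝ} (hg : Measurable g) (h0 : ∀ x, 0 ≤ g x)
    (hint : Integrable (fun x => Real.log (1 + g x)) α) :
    ‖gammaLaplace α fun x => (g x : ℂ)‖ ≤ P.real {s | ∑' k, ENNReal.ofReal (jump a s k * g (s k).2.1) ≠ ⊤} := by
  have := hP.isProbabilityMeasure
  have hf := IsLaplaceTest.of_nonneg hg h0 hint
  have hmS : ∀ n, Measurable fun s : ℕ → ℝ × X × ℝ =>
      ∑ k ∈ Finset.range n, jump a s k * g (s k).2.1 := fun n =>
    Finset.measurable_fun_sum _ fun k _ => (measurable_jump k).mul (hg.comp (by fun_prop))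
  let F : ℕ → (ℕ → ℝ × X × ℝ) → ℝ := fun n s =>
    Real.exp (-∑ k ∈ Finset.range n, jump a s k * g (s k).2.1)
  have hFm : ∀ n, Measurable (F n) := fun n => (hmS n).neg.exp
  have hle : ∀ n, ‖gammaLaplace α fun x => (g x : ℂ)‖ ≤ ∫ s, F n s ∂P := fun n => by
    rw [← hP.integral_partialIntegral ha hα hf n]
    refine norm_integral_le_of_norm_le ?_ ?_
    · refine (integrable_const (1 : ℝ)).mono' (hFm n).aestronglyMeasurable ?_
      filter_upwards [hP.ae_mem ha hα] with s hs
      rw [Real.norm_of_nonneg (Real.exp_pos _).le, Real.exp_le_one_iff, neg_nonpos]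
      exact Finset.sum_nonneg fun k _ => mul_nonneg (jump_pos ha hs k).le (h0 _)
    · filter_upwards [hP.ae_mem ha hα] with s hs
      have hR := shrinkage_mem_Ioc ha hs n
      rw [norm_mul, Complex.norm_exp]
      refine (mul_le_of_le_one_right (Real.exp_pos _).le
        (norm_gammaLaplace_le_one (hf.real_mul hR.1.le hR.2).re_nonneg)).trans (le_of_eq ?_)
      simp [F, partialIntegral, Complex.re_sum]
  set T : Set (ℕ → ℝ × X × ℝ) := {s | ∑' k, ENNReal.ofReal (jump a s k * g (s k).2.1) ≠ ⊤} with hT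
  have hSm : MeasurableSet T := by
    refine (Measurable.tsum fun k => ?_) (measurableSet_singleton ⊤).compl
    exact ((measurable_jump k).mul (hg.comp (by fun_prop))).ennreal_ofReal
  let G : (ℕ → ℝ × X × ℝ) → ℝ := T.indicator
    fun s => Real.exp (-∑' k, jump a s k * g (s k).2.1)
  have hlim : Filter.Tendsto (fun n => ∫ s, F n s ∂P) Filter.atTop (𝓝 (∫ s, G s ∂P)) := by
    refine tendsto_integral_of_dominated_convergence (fun _ => 1)
      (fun n => (hFm n).aestronglyMeasurable) (integrable_const _) (fun n => ?_) ?_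
    · filter_upwards [hP.ae_mem ha hα] with s hs
      rw [Real.norm_of_nonneg (Real.exp_pos _).le, Real.exp_le_one_iff, neg_nonpos]
      exact Finset.sum_nonneg fun k _ => mul_nonneg (jump_pos ha hs k).le (h0 _)
    · filter_upwards [hP.ae_mem ha hα] with s hs
      have hiff := summable_iff_tsum_ofReal_ne_top
        fun k => mul_nonneg (jump_pos ha hs k).le (h0 (s k).2.1)
      by_cases h : s ∈ T
      · have h' := hiff.2 h
        rw [show G s = Real.exp (-∑' k, jump a s k * g (s k).2.1) from indicator_of_mem h _]
        exact (Real.continuous_exp.tendsto _).comp h'.hasSum.tendsto_sum_nat.neg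
      · rw [show G s = 0 from indicator_of_notMem h _]
        refine Real.tendsto_exp_neg_atTop_nhds_zero.comp ?_
        exact (not_summable_iff_tendsto_nat_atTop_of_nonneg
          fun k => mul_nonneg (jump_pos ha hs k).le (h0 _)).1 (mt hiff.1 h)
  refine (ge_of_tendsto' hlim hle).trans ?_
  rw [← integral_indicator_one hSm]
  refine integral_mono_of_nonneg (ae_of_all _ fun s => indicator_nonneg (fun _ _ => (Real.exp_pos _).le) s)
    ((integrable_const (1 : ℝ)).indicator hSm) ?_
  filter_upwards [hP.ae_mem ha hα] with s hs
  refine indicator_le_indicator ?_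
  rw [Pi.one_apply, Real.exp_le_one_iff, neg_nonpos]
  exact tsum_nonneg fun k => mul_nonneg (jump_pos ha hs k).le (h0 _)

/-- Convergence of the series is unaffected by replacing `‖f‖` by `r ‖f‖` with `r > 0`. Its
probability is therefore at least `‖L(r ‖f‖)‖` for all small `r`, and this tends to `1` as `r → 0`.
-/
lemma IsGammaSample.ae_summable [Inhabited X] [IsFiniteMeasure α] (hP : IsGammaSample a α P)
    (ha : 0 < a) (hα : α univ = ENNReal.ofReal a) (hf : IsLaplaceTest α f) :
    ∀ᵐ s ∂P, Summable fun k => jump a s k * ‖f (s k).2.1‖ := by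
  have := hP.isProbabilityMeasure
  have hg := hf.measurable.norm
  have htest := IsLaplaceTest.of_nonneg hg (fun x => norm_nonneg _) hf.integrable
  have hlim : Filter.Tendsto (fun r : ℝ => ‖gammaLaplace α fun x => r * (‖f x‖ : ℂ)‖)
      (𝓝[Ioc 0 1] 0) (𝓝 1) := by
    have := ((continuousOn_gammaLaplace_real_mul htest 0 (by simp)).mono Ioc_subset_Icc_self).norm
    simpa [ContinuousWithinAt] using this
  have hne : (𝓝[Ioc (0 : ℝ) 1] 0).NeBot := by
    rw [nhdsWithin_Ioc_eq_nhdsGT one_pos]; infer_instance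
  have hone : 1 ≤ P.real {s | ∑' k, ENNReal.ofReal (jump a s k * ‖f (s k).2.1‖) ≠ ⊤} := by
    refine le_of_tendsto hlim ?_
    filter_upwards [self_mem_nhdsWithin] with r hr
    have h := norm_gammaLaplace_le_measure_summable hP ha hα (hg.const_mul r)
      (fun x => mul_nonneg hr.1.le (norm_nonneg _)) (by
        have := (htest.real_mul hr.1.le hr.2).integrable
        simpa [abs_of_pos hr.1] using this)
    push_cast at h
    refine h.trans (le_of_eq ?_)
    congr 1
    ext s
    have h2 : ∀ k, ENNReal.ofReal (jump a s k * (r * ‖f (s k).2.1‖)) =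
        ENNReal.ofReal r * ENNReal.ofReal (jump a s k * ‖f (s k).2.1‖) := fun k => by
      rw [← ENNReal.ofReal_mul hr.1.le]; ring_nf
    simp only [mem_ofPred_eq, h2, ENNReal.tsum_mul_left]
    simp [ENNReal.mul_eq_top, hr.1]
  have hT : MeasurableSet {s : ℕ → ℝ × X × ℝ |
      ∑' k, ENNReal.ofReal (jump a s k * ‖f (s k).2.1‖) ≠ ⊤} := by
    refine (Measurable.tsum fun k => ?_) (measurableSet_singleton ⊤).compl
    exact ((measurable_jump k).mul (hg.comp (by fun_prop))).ennreal_ofReal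
  have hae := (prob_compl_eq_zero_iff hT).2
    ((ENNReal.toReal_eq_one_iff _).1 (le_antisymm measureReal_le_one hone))
  filter_upwards [hP.ae_mem ha hα, (show ∀ᵐ s ∂P, _ from hae)] with s hs h
  exact (summable_iff_tsum_ofReal_ne_top
    fun k => mul_nonneg (jump_pos ha hs k).le (norm_nonneg _)).2 h

/-- In the iterated identity, whose value does not depend on `n`, the shrinkage tends to `0`, so the
remaining factor `L(R_n f)` tends to `1`. -/
lemma IsGammaSample.integral_exp_neg_tsum [Inhabited X] [IsFiniteMeasure α]
    (hP : IsGammaSample a α P) (ha : 0 < a) (hα : α univ = ENNReal.ofReal a)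
    (hf : IsLaplaceTest α f) :
    ∫ s, Complex.exp (-∑' k, jump a s k * f (s k).2.1) ∂P = gammaLaplace α f := by
  have := hP.isProbabilityMeasure
  have hm := hf.measurable
  have hlim : Filter.Tendsto (fun n => ∫ s, Complex.exp (-partialIntegral a f s n) *
      gammaLaplace α (fun x => (shrinkage a s n) * f x) ∂P) Filter.atTop
      (𝓝 (∫ s, Complex.exp (-∑' k, jump a s k * f (s k).2.1) ∂P)) := by
    refine tendsto_integral_of_dominated_convergence (fun _ => 1) (fun n => ?_)
      (integrable_const _) (fun n => ?_) ?_
    · exact ((measurable_partialIntegral hm n).neg.cexp.mul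
        ((measurable_gammaLaplace_real_mul hm).comp (measurable_shrinkage n))).aestronglyMeasurable
    · filter_upwards [hP.ae_mem ha hα] with s hs
      have hR := shrinkage_mem_Ioc ha hs n
      rw [norm_mul]
      exact mul_le_one₀ (norm_exp_neg_le_one (partialIntegral_re_nonneg ha hf.re_nonneg hs _))
        (norm_nonneg _) (norm_gammaLaplace_le_one (hf.real_mul hR.1.le hR.2).re_nonneg)
    · filter_upwards [hP.ae_mem ha hα, hP.ae_summable ha hα hf, hP.ae_tendsto_shrinkage ha hα]
        with s hs hsum hR
      have h1 : Summable fun k => (jump a s k : ℂ) * f (s k).2.1 := by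
        refine Summable.of_norm (hsum.congr fun k => ?_)
        rw [norm_mul, Complex.norm_real, Real.norm_of_nonneg (jump_pos ha hs k).le]
      have h2 : Filter.Tendsto (fun n => Complex.exp (-partialIntegral a f s n)) Filter.atTop
          (𝓝 (Complex.exp (-∑' k, jump a s k * f (s k).2.1))) :=
        (Complex.continuous_exp.tendsto _).comp h1.hasSum.tendsto_sum_nat.neg
      have h3 : Filter.Tendsto (fun n => gammaLaplace α (fun x => (shrinkage a s n) * f x))
          Filter.atTop (𝓝 1) := by
        have hc := continuousOn_gammaLaplace_real_mul hf 0 (by simp)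
        have ht : Filter.Tendsto (shrinkage a s) Filter.atTop (𝓝[Icc 0 1] 0) :=
          tendsto_nhdsWithin_of_tendsto_nhds_of_eventually_within _ hR
            (Filter.Eventually.of_forall fun n => Ioc_subset_Icc_self (shrinkage_mem_Ioc ha hs n))
        simpa [ContinuousWithinAt, Function.comp_def] using Filter.Tendsto.comp hc ht
      simpa using h2.mul h3
  simp_rw [hP.integral_partialIntegral ha hα hf] at hlim
  exact (tendsto_nhds_unique hlim tendsto_const_nhds)

/-- The gamma random measure: the sum of the atoms `jump a s k` at the points of the sample. -/
noncomputable def gammaRandomMeasure (a : ℝ) (s : ℕ → ℝ × X × ℝ) : Measure X :=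
  Measure.sum fun k => ENNReal.ofReal (jump a s k) • Measure.dirac (s k).2.1

lemma measurable_gammaRandomMeasure : Measurable (gammaRandomMeasure (X := X) a) := by
  refine Measure.measurable_of_measurable_coe _ fun B hB => ?_
  simp only [gammaRandomMeasure, Measure.sum_apply _ hB, Measure.smul_apply,
    Measure.dirac_apply' _ hB, smul_eq_mul]
  refine Measurable.tsum fun k => (measurable_jump k).ennreal_ofReal.mul ?_
  exact (measurable_one.indicator hB).comp (by fun_prop)

lemma IsGammaSample.ae_integrable [Inhabited X] [IsFiniteMeasure α] (hP : IsGammaSample a α P)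
    (ha : 0 < a) (hα : α univ = ENNReal.ofReal a) (hf : IsLaplaceTest α f) :
    ∀ᵐ s ∂P, Integrable f (gammaRandomMeasure a s) := by
  filter_upwards [hP.ae_mem ha hα, hP.ae_summable ha hα hf] with s hs hsum
  refine ⟨hf.measurable.aestronglyMeasurable, ?_⟩
  rw [hasFiniteIntegral_iff_enorm, gammaRandomMeasure, lintegral_sum_measure]
  have h : ∀ k, ∫⁻ x, ‖f x‖ₑ ∂(ENNReal.ofReal (jump a s k) • Measure.dirac (s k).2.1) =
      ENNReal.ofReal (jump a s k * ‖f (s k).2.1‖) := fun k => by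
    rw [lintegral_smul_measure, lintegral_dirac' _ hf.measurable.enorm, smul_eq_mul,
      ENNReal.ofReal_mul (jump_pos ha hs k).le, ofReal_norm]
  rw [tsum_congr h]
  exact lt_of_le_of_ne le_top ((summable_iff_tsum_ofReal_ne_top
    fun k => mul_nonneg (jump_pos ha hs k).le (norm_nonneg _)).1 hsum)

/-- The Laplace functional of the gamma random measure. -/
lemma IsGammaSample.integral_exp_neg_integral [Inhabited X] [IsFiniteMeasure α]
    (hP : IsGammaSample a α P) (ha : 0 < a) (hα : α univ = ENNReal.ofReal a)
    (hf : IsLaplaceTest α f) :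
    ∫ s, Complex.exp (-∫ x, f x ∂(gammaRandomMeasure a s)) ∂P = gammaLaplace α f := by
  rw [← hP.integral_exp_neg_tsum ha hα hf]
  refine integral_congr_ae ?_
  filter_upwards [hP.ae_mem ha hα, hP.ae_integrable ha hα hf] with s hs hint
  rw [gammaRandomMeasure, integral_sum_measure hint]
  congr 3 with k
  rw [integral_smul_measure, integral_dirac' _ _ hf.measurable.stronglyMeasurable,
    ENNReal.toReal_ofReal (jump_pos ha hs k).le, Complex.real_smul]

lemma IsLaplaceTest.of_bounded [IsFiniteMeasure α] (hf : Measurable f) (h0 : ∀ x, 0 ≤ (f x).re)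
    {C : ℝ} (hC : ∀ x, ‖f x‖ ≤ C) : IsLaplaceTest α f where
  measurable := hf
  re_nonneg := h0
  integrable := by
    refine (integrable_const (Real.log (1 + C))).mono'
      (Measurable.aestronglyMeasurable (by fun_prop)) (ae_of_all _ fun x => ?_)
    have := norm_nonneg (f x)
    rw [Real.norm_of_nonneg (Real.log_nonneg (by linarith))]
    exact Real.log_le_log (by linarith) (by linarith [hC x])

lemma IsGammaSample.ae_isFiniteMeasure [Inhabited X] [IsFiniteMeasure α] (hP : IsGammaSample a α P)
    (ha : 0 < a) (hα : α univ = ENNReal.ofReal a) :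
    ∀ᵐ s ∂P, IsFiniteMeasure (gammaRandomMeasure a s) ∧ gammaRandomMeasure a s univ ≠ 0 := by
  have h1 : IsLaplaceTest α (fun _ => (1 : ℂ)) :=
    IsLaplaceTest.of_bounded measurable_const (by simp) (C := 1) (by simp)
  filter_upwards [hP.ae_mem ha hα, hP.ae_integrable ha hα h1] with s hs h
  refine ⟨(integrable_const_iff_isFiniteMeasure one_ne_zero).1 h, ?_⟩
  rw [gammaRandomMeasure, Measure.sum_apply _ MeasurableSet.univ]
  simp only [Measure.smul_apply, measure_univ, smul_eq_mul, mul_one, ne_eq, ENNReal.tsum_eq_zero,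
    not_forall]
  exact ⟨0, by simpa using jump_pos ha hs 0⟩

end GammaProcess

/-! ### Normalization of a random measure. -/

section Normalize

variable {X : Type*} [MeasurableSpace X]

open Classical in
/-- The probability measure proportional to `μ`, and the unit mass at the default point if there is
none. -/
noncomputable def normalizeMeasure [Inhabited X] (μ : Measure X) : ProbabilityMeasure X :=
  ⟨if μ univ ≠ 0 ∧ μ univ ≠ ⊤ then (μ univ)⁻¹ • μ else Measure.dirac default, by
    split_ifs with h
    · exact ⟨by simp [ENNReal.inv_mul_cancel h.1 h.2]⟩
    · infer_instance⟩

lemma coe_normalizeMeasure [Inhabited X] {μ : Measure X} (h : IsFiniteMeasure μ ∧ μ univ ≠ 0) :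
    (normalizeMeasure μ : Measure X) = (μ univ)⁻¹ • μ :=
  if_pos ⟨h.2, h.1.measure_univ_lt_top.ne⟩

lemma measurable_normalizeMeasure [Inhabited X] :
    Measurable (normalizeMeasure : Measure X → ProbabilityMeasure X) := by
  refine Measurable.subtype_mk ?_
  have hu : Measurable fun μ : Measure X => μ univ := Measure.measurable_coe MeasurableSet.univ
  refine Measurable.ite ?_ ?_ measurable_const
  · exact (hu (measurableSet_singleton 0).compl).inter (hu (measurableSet_singleton ⊤).compl)
  · refine Measure.measurable_of_measurable_coe _ fun B hB => ?_
    simp only [Measure.smul_apply, smul_eq_mul]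
    exact hu.inv.mul (Measure.measurable_coe hB)

lemma measurable_probabilityMeasure_real {B : Set X} (hB : MeasurableSet B) :
    Measurable fun φ : ProbabilityMeasure X => (φ : Measure X).real B :=
  ((Measure.measurable_coe hB).comp measurable_subtype_coe).ennreal_toReal

end Normalize

/-! ### Existence and uniqueness of the Dirichlet process. -/

section DirichletProcess

lemma isProbabilityMeasure_gammaLaw_of_nonneg {b : ℝ} (hb : 0 ≤ b) :
    IsProbabilityMeasure (gammaLaw b) := by
  unfold gammaLaw
  split_ifs with h
  · infer_instance
  · exact isProbabilityMeasure_gammaMeasure (lt_of_le_of_ne hb (Ne.symm h)) one_pos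

lemma integral_exp_neg_mul_gammaLaw {b : ℝ} (hb : 0 ≤ b) {z : ℂ} (hz : 0 ≤ z.re) :
    ∫ x, Complex.exp (-(z * x)) ∂(gammaLaw b) = Complex.exp (-(b * Complex.log (1 + z))) := by
  unfold gammaLaw
  split_ifs with h
  · simp [h]
  · exact integral_exp_neg_mul_gammaMeasure (lt_of_le_of_ne hb (Ne.symm h)) hz

variable {a : ℝ} {α : Measure ℝ} {P : Measure (ℕ → ℝ × ℝ × ℝ)}

lemma measurable_gammaRandomMeasure_real {B : Set ℝ} (hB : MeasurableSet B) :
    Measurable fun s : ℕ → ℝ × ℝ × ℝ => (gammaRandomMeasure a s).real B :=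
  ((Measure.measurable_coe hB).comp measurable_gammaRandomMeasure).ennreal_toReal

section Partition

variable {ι : Type*} [Fintype ι] {C : ι → Set ℝ}

lemma sum_indicator_of_mem [DecidableEq ι] (hd : Pairwise (fun i j => Disjoint (C i) (C j))) {M : Type*}
    [AddCommMonoid M] (t : ι → M) {i : ι} {x : ℝ} (hx : x ∈ C i) :
    ∑ j, (C j).indicator (fun _ => t j) x = t i := by
  rw [Finset.sum_eq_single i, indicator_of_mem hx]
  · intro j _ hj
    exact indicator_of_notMem (fun h => (hd hj).le_bot ⟨h, hx⟩) _
  · simp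

lemma gammaLaplace_partition [IsFiniteMeasure α] (hC : ∀ i, MeasurableSet (C i))
    (hd : Pairwise (fun i j => Disjoint (C i) (C j))) (hu : ⋃ i, C i = univ) (t : ι → ℂ) :
    gammaLaplace α (fun x => ∑ j, (C j).indicator (fun _ => t j) x) =
      ∏ i, Complex.exp (-(α.real (C i) * Complex.log (1 + t i))) := by
  classical
  have h : ∀ x, Complex.log (1 + ∑ j, (C j).indicator (fun _ => t j) x) =
      ∑ j, (C j).indicator (fun _ => Complex.log (1 + t j)) x := fun x => by
    obtain ⟨i, hi⟩ := mem_iUnion.1 (hu ▸ mem_univ x)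
    rw [sum_indicator_of_mem hd _ hi, sum_indicator_of_mem hd _ hi]
  simp_rw [gammaLaplace, h]
  rw [integral_finsetSum _ fun i _ => (integrable_const _).indicator (hC i), ← Complex.exp_sum,
    Finset.sum_neg_distrib]
  simp_rw [integral_indicator_const _ (hC _), Complex.real_smul]

/-- The masses that the gamma random measure gives to the sets of a partition are independent
and gamma distributed. -/
lemma IsGammaSample.map_real_partition [IsFiniteMeasure α] (hP : IsGammaSample a α P) (ha : 0 < a)
    (hα : α univ = ENNReal.ofReal a) (hC : ∀ i, MeasurableSet (C i))
    (hd : Pairwise (fun i j => Disjoint (C i) (C j))) (hu : ⋃ i, C i = univ) :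
    P.map (fun s i => (gammaRandomMeasure a s).real (C i)) =
      Measure.pi fun i => gammaLaw (α.real (C i)) := by
  classical
  have := hP.isProbabilityMeasure
  have hpr : ∀ i, IsProbabilityMeasure (gammaLaw (α.real (C i))) := fun i =>
    isProbabilityMeasure_gammaLaw_of_nonneg measureReal_nonneg
  have hmeas : Measurable fun (s : ℕ → ℝ × ℝ × ℝ) i => (gammaRandomMeasure a s).real (C i) :=
    measurable_pi_lambda _ fun i => measurable_gammaRandomMeasure_real (hC i)
  refine charFunDual_eq_pi_iff.1 fun L => ?_
  -- For these imaginary values, the characteristic function of the vector of masses is the Laplace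
  -- functional at the step function equal to `t i` on `C i`.
  set t : ι → ℂ := fun i => -(L (Pi.single i 1) * Complex.I) with ht
  have hL : ∀ z, L z = ∑ i, L (Pi.single i 1) * z i := fun z => by
    conv_lhs => rw [← Finset.univ_sum_single z, map_sum]
    refine Finset.sum_congr rfl fun i _ => ?_
    rw [mul_comm, ← smul_eq_mul, ← map_smul, ← Pi.single_smul, smul_eq_mul, mul_one]
  have htre : ∀ i, (t i).re = 0 := fun i => by simp [ht]
  have hf : IsLaplaceTest α (fun x => ∑ j, (C j).indicator (fun _ => t j) x) := by
    refine IsLaplaceTest.of_bounded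
      (Finset.measurable_fun_sum _ fun i _ => measurable_const.indicator (hC i)) (fun x => ?_)
      (C := ∑ i, ‖t i‖) fun x => ?_
    · rw [Complex.re_sum]
      refine (Finset.sum_nonneg fun i _ => ?_)
      by_cases hx : x ∈ C i <;> simp [hx, htre]
    · exact norm_sum_le_of_le _ fun i _ => norm_indicator_le_norm_self _ _
  have hrhs : ∀ i, charFunDual (gammaLaw (α.real (C i))) (L.comp (.single ℝ (fun _ => ℝ) i)) =
      Complex.exp (-(α.real (C i) * Complex.log (1 + t i))) := fun i => by
    rw [← integral_exp_neg_mul_gammaLaw measureReal_nonneg (htre i).ge, charFunDual_apply]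
    congr with x
    have : L (Pi.single i x) = L (Pi.single i 1) * x := by
      rw [mul_comm, ← smul_eq_mul, ← map_smul, ← Pi.single_smul, smul_eq_mul, mul_one]
    simp [ht, this]
    ring_nf
  simp_rw [hrhs]
  rw [← gammaLaplace_partition hC hd hu, ← hP.integral_exp_neg_integral ha hα hf, charFunDual_apply,
    integral_map hmeas.aemeasurable (by fun_prop)]
  refine integral_congr_ae ?_
  filter_upwards [hP.ae_isFiniteMeasure ha hα] with s hs
  have := hs.1
  rw [integral_finsetSum _ fun i _ => (integrable_const _).indicator (hC i)]
  rw [hL]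
  simp_rw [integral_indicator_const _ (hC _), Complex.real_smul]
  congr 1
  push_cast
  rw [Finset.sum_mul, ← Finset.sum_neg_distrib]
  refine Finset.sum_congr rfl fun i _ => ?_
  simp only [ht]
  ring

end Partition

/-- The normalized gamma random measure is a Dirichlet process. -/
lemma IsGammaSample.isDirichletProcess [IsFiniteMeasure α] (hP : IsGammaSample a α P) (ha : 0 < a)
    (hα : α univ = ENNReal.ofReal a) :
    IsDirichletProcess α (P.map fun s => normalizeMeasure (gammaRandomMeasure a s)) := by
  have := hP.isProbabilityMeasure
  have hm : Measurable fun s : ℕ → ℝ × ℝ × ℝ => normalizeMeasure (gammaRandomMeasure a s) :=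
    measurable_normalizeMeasure.comp measurable_gammaRandomMeasure
  refine ⟨Measure.isProbabilityMeasure_map hm.aemeasurable, fun n C hC hd hu => ?_⟩
  rw [dirichletDistribution, ← hP.map_real_partition ha hα hC hd hu, Measure.map_map
    (measurable_pi_lambda _ fun i => measurable_probabilityMeasure_real (hC i)) hm,
    Measure.map_map (by fun_prop)
      (measurable_pi_lambda _ fun i => measurable_gammaRandomMeasure_real (hC i))]
  refine Measure.map_congr ?_
  filter_upwards [hP.ae_isFiniteMeasure ha hα] with s hs
  have := hs.1
  funext i
  simp only [Function.comp, coe_normalizeMeasure hs]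
  rw [← measureReal_iUnion_fintype (μ := gammaRandomMeasure a s) hd hC, hu, measureReal_ennreal_smul_apply,
    ENNReal.toReal_inv, div_eq_inv_mul, measureReal_def (s := univ)]

/-- Only partitions have prescribed laws, so the sets `B i` are cut into the atoms of the algebra
they generate, indexed by `ι → Bool`. Each `φ (B i)` is a sum of masses of atoms; empty atoms do no
harm. -/
lemma IsDirichletProcess.map_eval_eq {D D' : Measure (ProbabilityMeasure ℝ)}
    (hD : IsDirichletProcess α D) (hD' : IsDirichletProcess α D') {ι : Type*} [Finite ι]
    (B : ι → Set ℝ) (hB : ∀ i, MeasurableSet (B i)) :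
    D.map (fun (φ : ProbabilityMeasure ℝ) i => (φ : Measure ℝ).real (B i)) = D'.map fun (φ : ProbabilityMeasure ℝ) i => (φ : Measure ℝ).real (B i) := by
  classical
  have := Fintype.ofFinite ι
  let e : Fin (Fintype.card (ι → Bool)) ≃ (ι → Bool) := (Fintype.equivFin _).symm
  let C : Fin (Fintype.card (ι → Bool)) → Set ℝ := fun j => ⋂ i, if e j i then B i else (B i)ᶜ
  have hmem : ∀ j x, x ∈ C j ↔ ∀ i, (x ∈ B i ↔ e j i = true) := fun j x => by
    rw [mem_iInter]
    refine forall_congr' fun i => ?_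
    cases h : e j i <;> simp
  have hC : ∀ j, MeasurableSet (C j) := fun j => MeasurableSet.iInter fun i => by
    split_ifs
    exacts [hB i, (hB i).compl]
  have hd : Pairwise (fun i j => Disjoint (C i) (C j)) := fun j k hjk => by
    refine Set.disjoint_left.2 fun x hx hx' => hjk (e.injective (funext fun i => ?_))
    rw [Bool.eq_iff_iff, ← (hmem j x).1 hx i, (hmem k x).1 hx' i]
  have hu : ⋃ j, C j = univ := by
    refine eq_univ_of_forall fun x => mem_iUnion.2 ⟨e.symm fun i => decide (x ∈ B i), ?_⟩
    rw [hmem]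
    simp
  let A : (Fin (Fintype.card (ι → Bool)) → ℝ) → ι → ℝ := fun z i => ∑ j, if e j i then z j else 0
  have hA : Measurable A := by
    refine measurable_pi_lambda _ fun i => Finset.measurable_fun_sum _ fun j _ => ?_
    split_ifs
    exacts [measurable_pi_apply j, measurable_const]
  have hcomp : (fun (φ : ProbabilityMeasure ℝ) i => (φ : Measure ℝ).real (B i)) =
      A ∘ fun (φ : ProbabilityMeasure ℝ) j => (φ : Measure ℝ).real (C j) := by
    funext φ i
    have hBi : B i = ⋃ j ∈ Finset.univ.filter (fun j => e j i = true), C j := by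
      ext x
      obtain ⟨k, hk⟩ := mem_iUnion.1 (hu ▸ mem_univ x)
      simp only [Finset.mem_filter, Finset.mem_univ, true_and, mem_iUnion, exists_prop]
      refine ⟨fun h => ⟨k, ((hmem k x).1 hk i).1 h, hk⟩, fun ⟨j, hj, hx⟩ => ((hmem j x).1 hx i).2 hj⟩
    rw [hBi, measureReal_biUnion_finset (fun j _ k _ h => hd h) fun j _ => hC j, Finset.sum_filter]
    rfl
  have hCm : Measurable fun (φ : ProbabilityMeasure ℝ) j => (φ : Measure ℝ).real (C j) :=
    measurable_pi_lambda _ fun j => measurable_probabilityMeasure_real (hC j)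
  rw [hcomp, ← Measure.map_map hA hCm, ← Measure.map_map hA hCm, hD.law_partition _ C hC hd hu,
    hD'.law_partition _ C hC hd hu]

/-- The functional Dirichlet distribution is determined by its finite-dimensional laws. -/
lemma IsDirichletProcess.unique {D D' : Measure (ProbabilityMeasure ℝ)}
    (hD : IsDirichletProcess α D) (hD' : IsDirichletProcess α D') : D = D' := by
  have := hD.isProbabilityMeasure
  have := hD'.isProbabilityMeasure
  let ev : ProbabilityMeasure ℝ → ({B : Set ℝ // MeasurableSet B} → ℝ) :=
    fun φ B => (φ : Measure ℝ).real B
  have hev : Measurable ev := measurable_pi_lambda _ fun B => measurable_probabilityMeasure_real B.2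
  have hmap : D.map ev = D'.map ev := by
    refine IsProjectiveLimit.unique (P := fun I => (D'.map ev).map I.restrict) (fun I => ?_)
      fun I => rfl
    have hI : Measurable (I.restrict (π := fun _ => ℝ)) := Finset.measurable_restrict I
    change _ = (D'.map ev).map I.restrict
    rw [Measure.map_map hI hev, Measure.map_map hI hev]
    exact hD.map_eval_eq hD' (fun B : I => B.1.1) fun B => B.1.2
  ext E hE
  -- Every event on probability measures is a preimage under the evaluation map, so equality of the
  -- image laws suffices.
  have hle : (inferInstance : MeasurableSpace (ProbabilityMeasure ℝ)) ≤
      MeasurableSpace.comap ev inferInstance := by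
    have hid : Measurable[MeasurableSpace.comap ev inferInstance]
        (fun φ : ProbabilityMeasure ℝ => φ) := by
      refine Measurable.subtype_mk (f := fun φ : ProbabilityMeasure ℝ => (φ : Measure ℝ)) ?_
      refine Measure.measurable_of_measurable_coe _ fun B hB => ?_
      have h : (fun φ : ProbabilityMeasure ℝ => (φ : Measure ℝ) B) =
          fun φ => ENNReal.ofReal (ev φ ⟨B, hB⟩) := by
        funext φ
        simp [ev]
      rw [h]
      exact ((measurable_pi_apply _).comp (comap_measurable ev)).ennreal_ofReal
    exact fun E hE => hid hE
  obtain ⟨F, hF, rfl⟩ := hle E hE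
  rw [← Measure.map_apply hev hF, hmap, Measure.map_apply hev hF]

end DirichletProcess

/-! ### The moment problem on the unit interval. -/

section Moments

lemma charFun_map_eq_tsum_moments {Ω : Type*} [MeasurableSpace Ω] {μ : Measure Ω}
    [IsFiniteMeasure μ] {Y : Ω → ℝ} (hY : Measurable Y) (hY1 : ∀ᵐ ω ∂μ, Y ω ∈ Icc (0 : ℝ) 1) (t : ℝ) :
    charFun (μ.map Y) t =
      ∑' n : ℕ, ((t * Complex.I) ^ n / (n.factorial : ℂ)) * ((∫ ω, Y ω ^ n ∂μ : ℝ) : ℂ) := by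
  have hbound : ∀ n : ℕ, ∀ᵐ ω ∂μ, ‖((t * Complex.I) ^ n / (n.factorial : ℂ)) * ((Y ω ^ n : ℝ) : ℂ)‖ ≤
      |t| ^ n / n.factorial := fun n => by
    filter_upwards [hY1] with ω hω
    rw [norm_mul, norm_div, norm_pow, norm_mul, Complex.norm_I, mul_one, Complex.norm_natCast,
      Complex.norm_real, Complex.norm_real, Real.norm_eq_abs, Real.norm_of_nonneg (pow_nonneg hω.1 n)]
    exact mul_le_of_le_one_right (by positivity) (pow_le_one₀ hω.1 hω.2)
  have hint : ∀ n : ℕ, Integrable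
      (fun ω => ((t * Complex.I) ^ n / (n.factorial : ℂ)) * ((Y ω ^ n : ℝ) : ℂ)) μ := fun n =>
    (integrable_const _).mono' (Measurable.aestronglyMeasurable (by fun_prop)) (hbound n)
  rw [charFun_apply_real, integral_map hY.aemeasurable (by fun_prop)]
  have hsum := integral_tsum_of_summable_integral_norm hint (by
    refine Summable.of_nonneg_of_le (fun n => integral_nonneg fun ω => norm_nonneg _)
      (fun n => ?_) ((Real.summable_pow_div_factorial |t|).mul_right (μ.real univ))
    refine (integral_mono_ae (hint n).norm (integrable_const _) (hbound n)).trans (le_of_eq ?_)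
    simp [mul_comm])
  simp_rw [integral_const_mul, integral_complex_ofReal] at hsum
  rw [hsum]
  refine integral_congr_ae (ae_of_all _ fun ω => ?_)
  simp only
  rw [Complex.exp_eq_exp_ℂ, NormedSpace.exp_eq_tsum_div]
  refine tsum_congr fun n => ?_
  push_cast
  ring

/-- The law of a random variable with values in `[0, 1]` is determined by its moments. -/
lemma map_eq_map_of_forall_integral_pow_eq {Ω Ω' : Type*} [MeasurableSpace Ω] [MeasurableSpace Ω']
    {μ : Measure Ω} {ν : Measure Ω'} [IsFiniteMeasure μ] [IsFiniteMeasure ν] {Y : Ω → ℝ} {Z : Ω' → ℝ}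
    (hY : Measurable Y) (hZ : Measurable Z) (hY1 : ∀ᵐ ω ∂μ, Y ω ∈ Icc (0 : ℝ) 1)
    (hZ1 : ∀ᵐ ω ∂ν, Z ω ∈ Icc (0 : ℝ) 1) (h : ∀ n : ℕ, ∫ ω, Y ω ^ n ∂μ = ∫ ω, Z ω ^ n ∂ν) :
    μ.map Y = ν.map Z := by
  refine Measure.ext_of_charFun (funext fun t => ?_)
  rw [charFun_map_eq_tsum_moments hY hY1, charFun_map_eq_tsum_moments hZ hZ1]
  simp_rw [h]

end Moments

/-! ### Recovering a finite measure from its Cauchy transform on the imaginary axis. -/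

section CauchyTransform

variable {α β : Measure ℝ}

/-- Averaging `exp (i t x e)` over a standard exponential `e` gives `(1 - i t x)⁻¹`, so the
hypothesis is an equality of characteristic functions. -/
lemma map_exp_mul_eq [IsFiniteMeasure α] [IsFiniteMeasure β]
    (h : ∀ t : ℝ, ∫ x, (1 + -(t * x * Complex.I) : ℂ)⁻¹ ∂α = ∫ x, (1 + -(t * x * Complex.I) : ℂ)⁻¹ ∂β) :
    (α.prod (expMeasure 1)).map (fun p => p.1 * p.2) =
      (β.prod (expMeasure 1)).map (fun p => p.1 * p.2) := by
  have key : ∀ (α : Measure ℝ) [IsFiniteMeasure α] (t : ℝ),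
      charFun ((α.prod (expMeasure 1)).map (fun p => p.1 * p.2)) t =
        ∫ x, (1 + -(t * x * Complex.I) : ℂ)⁻¹ ∂α := by
    intro α _ t
    rw [charFun_apply_real, integral_map (by fun_prop) (by fun_prop), integral_prod]
    · refine integral_congr_ae (ae_of_all _ fun x => ?_)
      simp only
      rw [← integral_exp_neg_mul_expMeasure (by simp)]
      congr with e
      push_cast
      ring_nf
    · refine (integrable_const (1 : ℝ)).mono' (Measurable.aestronglyMeasurable (by fun_prop))
        (ae_of_all _ fun p => ?_)
      have := Complex.norm_exp_ofReal_mul_I (t * (p.1 * p.2))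
      push_cast at this ⊢
      exact this.le
  refine Measure.ext_of_charFun (funext fun t => ?_)
  rw [key, key, h]

lemma expMeasure_Ioi {y : ℝ} (hy : 0 ≤ y) : (expMeasure 1).real (Ioi y) = Real.exp (-y) := by
  have := cdf_expMeasure_eq one_pos y
  rw [cdf_eq_real, if_pos hy, one_mul] at this
  rw [← compl_Iic, probReal_compl_eq_one_sub measurableSet_Iic, this]
  ring

/-- For `x > 0` the event `x e > n` has exponential probability `exp (-n / x)`; for `x ≤ 0` it is
null, as `n ≥ 0` and `e > 0` almost surely. -/
lemma integral_exp_neg_inv_pow [IsFiniteMeasure α] (n : ℕ) :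
    ∫ x in Ioi (0 : ℝ), Real.exp (-x⁻¹) ^ n ∂α =
      ((α.prod (expMeasure 1)).map (fun p => p.1 * p.2)).real (Ioi (n : ℝ)) := by
  have hms : MeasurableSet {p : ℝ × ℝ | (n : ℝ) < p.1 * p.2} :=
    measurableSet_lt measurable_const (by fun_prop)
  rw [map_measureReal_apply (by fun_prop) measurableSet_Ioi, ← integral_indicator measurableSet_Ioi]
  change _ = (α.prod (expMeasure 1)).real {p : ℝ × ℝ | (n : ℝ) < p.1 * p.2}
  rw [← integral_indicator_one hms, integral_prod _
    (show Integrable (indicator _ (1 : ℝ × ℝ → ℝ)) _ from (integrable_const (1 : ℝ)).indicator hms)]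
  refine integral_congr_ae (ae_of_all _ fun x => ?_)
  have hsec : ∀ e : ℝ, {p : ℝ × ℝ | (n : ℝ) < p.1 * p.2}.indicator (1 : ℝ × ℝ → ℝ) (x, e) =
      {e : ℝ | (n : ℝ) < x * e}.indicator (1 : ℝ → ℝ) e := fun e => by
    simp [indicator_apply]
  have hm2 : MeasurableSet {e : ℝ | (n : ℝ) < x * e} := measurableSet_lt measurable_const (by fun_prop)
  simp only [hsec]
  rw [integral_indicator_one hm2]
  by_cases hx : 0 < x
  · rw [indicator_of_mem (show x ∈ Ioi 0 from hx)]
    have : {e : ℝ | (n : ℝ) < x * e} = Ioi (n * x⁻¹) := by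
      ext e
      rw [mem_ofPred_eq, mem_Ioi, ← div_eq_mul_inv, div_lt_iff₀ hx, mul_comm]
    rw [this, expMeasure_Ioi (by positivity), ← Real.exp_nat_mul]
    ring_nf
  · rw [indicator_of_notMem (by simpa using hx), measureReal_def]
    symm
    have hz : (expMeasure 1) {e : ℝ | (n : ℝ) < x * e} = 0 := by
      refine measure_mono_null (fun e he => ?_) (ae_iff.1 ae_expMeasure_nonneg)
      have h1 : (n : ℝ) < x * e := he
      intro h2
      nlinarith [mul_nonneg (neg_nonneg.2 (not_lt.1 hx)) h2.le, Nat.cast_nonneg (α := ℝ) n]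
    rw [hz]
    rfl

/-- The tails of the product law at integers are the moments of `exp (-1/x)` over the positive
half-line. They determine the image of the restricted measure, and `x ↦ exp (-1/x)` can be inverted.
-/
lemma restrict_Ioi_eq_of_forall_integral_inv_eq [IsFiniteMeasure α] [IsFiniteMeasure β]
    (h : ∀ t : ℝ, ∫ x, (1 + -(t * x * Complex.I) : ℂ)⁻¹ ∂α = ∫ x, (1 + -(t * x * Complex.I) : ℂ)⁻¹ ∂β) :
    α.restrict (Ioi 0) = β.restrict (Ioi 0) := by
  have hY : Measurable fun x : ℝ => Real.exp (-x⁻¹) := by fun_prop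
  have hmem : ∀ {γ : Measure ℝ}, ∀ᵐ x ∂(γ.restrict (Ioi 0)), Real.exp (-x⁻¹) ∈ Icc (0 : ℝ) 1 := by
    intro γ
    filter_upwards [ae_restrict_mem measurableSet_Ioi] with x hx
    exact ⟨(Real.exp_pos _).le, by simpa using (mem_Ioi.1 hx).le⟩
  have hmap := map_eq_map_of_forall_integral_pow_eq (μ := α.restrict (Ioi 0)) (ν := β.restrict (Ioi 0))
    hY hY hmem hmem fun n => by
      rw [integral_exp_neg_inv_pow, integral_exp_neg_inv_pow, map_exp_mul_eq h]
  have hinv : Measurable fun y : ℝ => -(Real.log y)⁻¹ := by fun_prop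
  have hback : ∀ γ : Measure ℝ, (γ.map fun x : ℝ => Real.exp (-x⁻¹)).map (fun y => -(Real.log y)⁻¹) = γ :=
    fun γ => by
      rw [Measure.map_map hinv hY]
      -- This holds on all of `ℝ`, also at `x = 0`, thanks to `0⁻¹ = 0` and `log 1 = 0`.
      have : (fun y : ℝ => -(Real.log y)⁻¹) ∘ (fun x : ℝ => Real.exp (-x⁻¹)) = id := by
        funext x
        simp [Function.comp]
      rw [this, Measure.map_id]
  rw [← hback (α.restrict (Ioi 0)), hmap, hback]

/-- A finite measure on the line is determined by `t ↦ ∫ (1 - i t x)⁻¹ dα`. -/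
lemma ext_of_forall_integral_inv_eq [IsFiniteMeasure α] [IsFiniteMeasure β]
    (h : ∀ t : ℝ, ∫ x, (1 + -(t * x * Complex.I) : ℂ)⁻¹ ∂α = ∫ x, (1 + -(t * x * Complex.I) : ℂ)⁻¹ ∂β) :
    α = β := by
  have hpos := restrict_Ioi_eq_of_forall_integral_inv_eq h
  have hneg : (α.map (fun x => -x)).restrict (Ioi 0) = (β.map (fun x => -x)).restrict (Ioi 0) := by
    refine restrict_Ioi_eq_of_forall_integral_inv_eq fun t => ?_
    rw [integral_map (by fun_prop) (Measurable.aestronglyMeasurable (by fun_prop)),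
      integral_map (by fun_prop) (Measurable.aestronglyMeasurable (by fun_prop))]
    simpa using h (-t)
  have hIio : ∀ B, MeasurableSet B → α (B ∩ Iio 0) = β (B ∩ Iio 0) := fun B hB => by
    have hB' : MeasurableSet ((fun x : ℝ => -x) ⁻¹' B) := measurable_neg hB
    have hpre : (fun x : ℝ => -x) ⁻¹' ((fun x : ℝ => -x) ⁻¹' B ∩ Ioi 0) = B ∩ Iio 0 := by
      ext x; simp
    have := congrArg (fun γ : Measure ℝ => γ ((fun x : ℝ => -x) ⁻¹' B)) hneg
    simpa only [Measure.restrict_apply hB', Measure.map_apply measurable_neg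
      (hB'.inter measurableSet_Ioi), hpre] using this
  have hIoi : ∀ B, MeasurableSet B → α (B ∩ Ioi 0) = β (B ∩ Ioi 0) := fun B hB => by
    rw [← Measure.restrict_apply hB, hpos, Measure.restrict_apply hB]
  -- The value at `t = 0` is the total mass; once both open half-lines are matched, it fixes the
  -- atom at `0`.
  have hu : α univ = β univ := by
    have := h 0
    simp [measureReal_def] at this
    simpa [ENNReal.toReal_eq_toReal_iff'] using this
  have hsplit : ∀ (γ : Measure ℝ) (B : Set ℝ), MeasurableSet B →
      γ B = γ (B ∩ Iio 0) + γ (B ∩ Ioi 0) + γ (B ∩ {0}) := fun γ B hB => by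
    rw [← measure_union (by
      refine Set.disjoint_left.2 fun x hx hx' => ?_
      exact lt_asymm (mem_Iio.1 hx.2) (mem_Ioi.1 hx'.2)) (hB.inter measurableSet_Ioi),
      ← measure_union (by
        refine Set.disjoint_left.2 fun x hx hx' => ?_
        rcases hx with hx | hx
        · exact (mem_Iio.1 hx.2).ne hx'.2
        · exact (mem_Ioi.1 hx.2).ne' hx'.2) (hB.inter (measurableSet_singleton 0))]
    congr 1
    rw [← inter_union_distrib_left, ← inter_union_distrib_left]
    refine (inter_eq_left.2 fun x _ => ?_).symm
    by_cases hx : x = 0 <;> simp [hx]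
  have h0 : α {0} = β {0} := by
    have h1 := hsplit α univ MeasurableSet.univ
    have h2 := hsplit β univ MeasurableSet.univ
    rw [hu, h2, hIio _ MeasurableSet.univ, hIoi _ MeasurableSet.univ] at h1
    simp only [univ_inter] at h1
    exact ((ENNReal.add_right_inj (ENNReal.add_ne_top.2 ⟨measure_ne_top _ _, measure_ne_top _ _⟩)).1
      h1).symm
  ext B hB
  rw [hsplit α B hB, hsplit β B hB, hIio B hB, hIoi B hB]
  congr 1
  by_cases hmem : (0 : ℝ) ∈ B
  · rw [inter_eq_right.2 (singleton_subset_iff.2 hmem), h0]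
  · rw [inter_singleton_eq_empty.2 hmem]; simp

end CauchyTransform

/-! ### Total mass and mean of the gamma random measure. -/

section DirichletMean

variable {a : ℝ} {α : Measure ℝ} {P : Measure (ℕ → ℝ × ℝ × ℝ)}

lemma isFiniteMeasure_of_mem_measuresOfMass (h : α ∈ measuresOfMass a) : IsFiniteMeasure α :=
  ⟨h.1 ▸ ENNReal.ofReal_lt_top⟩

lemma integrable_log_of_mem_measuresOfMass (h : α ∈ measuresOfMass a) :
    Integrable (fun x : ℝ => Real.log (1 + |x|)) α := by
  refine ⟨Measurable.aestronglyMeasurable (by fun_prop), ?_⟩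
  rw [hasFiniteIntegral_iff_ofReal (ae_of_all _ fun x =>
    Real.log_nonneg (by linarith [abs_nonneg x]))]
  exact h.2

lemma IsLaplaceTest.affine (h : α ∈ measuresOfMass a) {z : ℂ} (hz : 0 ≤ z.re) {w : ℂ} (hw : w.re = 0) :
    IsLaplaceTest α fun x => z + w * x where
  measurable := by fun_prop
  re_nonneg x := by simp [hw, hz]
  integrable := by
    have := isFiniteMeasure_of_mem_measuresOfMass h
    refine ((integrable_log_of_mem_measuresOfMass h).add
      (integrable_const (Real.log (1 + ‖z‖ + ‖w‖)))).mono'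
      (Measurable.aestronglyMeasurable (by fun_prop)) (ae_of_all _ fun x => ?_)
    have h1 := norm_nonneg (z + w * x)
    have h2 := norm_nonneg z
    have h3 := norm_nonneg w
    have h4 := abs_nonneg x
    rw [Real.norm_of_nonneg (Real.log_nonneg (by linarith)), Pi.add_apply,
      ← Real.log_mul (by positivity) (by positivity)]
    refine Real.log_le_log (by positivity) ?_
    have h5 : ‖z + w * x‖ ≤ ‖z‖ + ‖w‖ * |x| := (norm_add_le _ _).trans (by simp)
    -- The inequality is `1 + ‖z + w x‖ ≤ (1 + |x|) (1 + ‖z‖ + ‖w‖)`.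
    nlinarith [mul_nonneg h2 h4, mul_nonneg h3 h4]

lemma isDirichletProcess_dirichletProcess (ha : 0 < a) (h : α ∈ measuresOfMass a) :
    IsDirichletProcess α (dirichletProcess α) := by
  have := isFiniteMeasure_of_mem_measuresOfMass h
  obtain ⟨P, hP⟩ := exists_isGammaSample ha h.1
  have hex : ∃ D, IsDirichletProcess α D := ⟨_, hP.isDirichletProcess ha h.1⟩
  rw [dirichletProcess, dif_pos hex]
  exact hex.choose_spec

lemma IsGammaSample.map_eq_dirichletProcess (hP : IsGammaSample a α P) (ha : 0 < a)
    (h : α ∈ measuresOfMass a) :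
    P.map (fun s => normalizeMeasure (gammaRandomMeasure a s)) = dirichletProcess α := by
  have := isFiniteMeasure_of_mem_measuresOfMass h
  exact (hP.isDirichletProcess ha h.1).unique (isDirichletProcess_dirichletProcess ha h)

lemma IsGammaSample.ae_integrable_id (hP : IsGammaSample a α P) (ha : 0 < a)
    (h : α ∈ measuresOfMass a) : ∀ᵐ s ∂P, Integrable (fun x : ℝ => x) (gammaRandomMeasure a s) := by
  have := isFiniteMeasure_of_mem_measuresOfMass h
  -- The function `x` leaves the right half-plane, but `i x` stays on its boundary and has the same
  -- norm.
  have ht : IsLaplaceTest α (fun x : ℝ => 0 + Complex.I * x) := IsLaplaceTest.affine h (by simp) (by simp)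
  filter_upwards [hP.ae_integrable ha h.1 ht] with s hs
  refine (integrable_norm_iff (by fun_prop)).1 ?_
  simpa using hs.norm

lemma ae_integrable_dirichletProcess (ha : 0 < a) (h : α ∈ measuresOfMass a) :
    ∀ᵐ (φ : ProbabilityMeasure ℝ) ∂(dirichletProcess α), Integrable (fun x : ℝ => x) (φ : Measure ℝ) := by
  have := isFiniteMeasure_of_mem_measuresOfMass h
  obtain ⟨P, hP⟩ := exists_isGammaSample ha h.1
  have hm : Measurable fun s : ℕ → ℝ × ℝ × ℝ => normalizeMeasure (gammaRandomMeasure a s) :=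
    measurable_normalizeMeasure.comp measurable_gammaRandomMeasure
  rw [← hP.map_eq_dirichletProcess ha h, ae_map_iff hm.aemeasurable]
  · filter_upwards [hP.ae_integrable_id ha h, hP.ae_isFiniteMeasure ha h.1] with s hs hfin
    rw [coe_normalizeMeasure hfin]
    exact hs.smul_measure (ENNReal.inv_ne_top.2 hfin.2)
  · have : {φ : ProbabilityMeasure ℝ | Integrable (fun x : ℝ => x) (φ : Measure ℝ)} =
        {φ : ProbabilityMeasure ℝ | ∫⁻ x, ‖x‖ₑ ∂(φ : Measure ℝ) < ⊤} := by
      ext φ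
      exact ⟨fun h => h.2, fun h => ⟨by fun_prop, h⟩⟩
    rw [this]
    exact measurableSet_lt ((Measure.measurable_lintegral (by fun_prop)).comp measurable_subtype_coe)
      measurable_const

lemma measurable_mean : Measurable fun φ : ProbabilityMeasure ℝ => ∫ x, x ∂(φ : Measure ℝ) := by
  let κ : Kernel (ProbabilityMeasure ℝ) ℝ := ⟨fun φ => (φ : Measure ℝ), measurable_subtype_coe⟩
  have : IsMarkovKernel κ := ⟨fun φ => inferInstanceAs (IsProbabilityMeasure (φ : Measure ℝ))⟩
  exact (StronglyMeasurable.integral_kernel (κ := κ) (f := fun x : ℝ => x) stronglyMeasurable_id).measurable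

/-- The mean of the normalized gamma random measure. -/
noncomputable def sampleMean (a : ℝ) (s : ℕ → ℝ × ℝ × ℝ) : ℝ :=
  ∫ x, x ∂(normalizeMeasure (gammaRandomMeasure a s) : Measure ℝ)

/-- The total mass of the gamma random measure. -/
noncomputable def sampleMass (a : ℝ) (s : ℕ → ℝ × ℝ × ℝ) : ℝ := (gammaRandomMeasure a s).real univ

lemma measurable_sampleMean : Measurable (sampleMean a) :=
  measurable_mean.comp (measurable_normalizeMeasure.comp measurable_gammaRandomMeasure)

lemma measurable_sampleMass : Measurable (sampleMass a) :=
  measurable_gammaRandomMeasure_real MeasurableSet.univ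

lemma IsGammaSample.map_sampleMean (hP : IsGammaSample a α P) (ha : 0 < a)
    (h : α ∈ measuresOfMass a) : P.map (sampleMean a) = dirichletMeanLaw α := by
  have hm : Measurable fun s : ℕ → ℝ × ℝ × ℝ => normalizeMeasure (gammaRandomMeasure a s) :=
    measurable_normalizeMeasure.comp measurable_gammaRandomMeasure
  rw [dirichletMeanLaw, ← hP.map_eq_dirichletProcess ha h, Measure.map_map measurable_mean hm]
  rfl

lemma IsGammaSample.ae_sampleMass_pos (hP : IsGammaSample a α P) (ha : 0 < a)
    (h : α ∈ measuresOfMass a) : ∀ᵐ s ∂P, 0 < sampleMass a s := by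
  have := isFiniteMeasure_of_mem_measuresOfMass h
  filter_upwards [hP.ae_isFiniteMeasure ha h.1] with s hs
  have := hs.1
  exact ENNReal.toReal_pos hs.2 (measure_ne_top _ _)

lemma IsGammaSample.ae_integral_eq (hP : IsGammaSample a α P) (ha : 0 < a)
    (h : α ∈ measuresOfMass a) :
    ∀ᵐ s ∂P, ∀ z w : ℂ, ∫ x : ℝ, (z + w * x) ∂(gammaRandomMeasure a s) =
      z * sampleMass a s + w * (sampleMass a s * sampleMean a s : ℝ) := by
  have := isFiniteMeasure_of_mem_measuresOfMass h
  filter_upwards [hP.ae_isFiniteMeasure ha h.1, hP.ae_integrable_id ha h,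
    hP.ae_sampleMass_pos ha h] with s hs hint hpos z w
  have := hs.1
  have hM : sampleMass a s * sampleMean a s = ∫ x, x ∂(gammaRandomMeasure a s) := by
    rw [sampleMean, coe_normalizeMeasure hs, integral_smul_measure, ENNReal.toReal_inv, smul_eq_mul]
    exact mul_inv_cancel_left₀ hpos.ne' _
  have hint' : Integrable (fun x : ℝ => w * (x : ℂ)) (gammaRandomMeasure a s) :=
    hint.ofReal.const_mul w
  rw [hM, integral_add (integrable_const _) hint', integral_const,
    integral_const_mul, integral_complex_ofReal, Complex.real_smul, mul_comm z]
  rfl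

/-- The joint Laplace–Fourier transform of the total mass and the first moment of the gamma random
measure. -/
lemma IsGammaSample.integral_exp_neg_affine (hP : IsGammaSample a α P) (ha : 0 < a)
    (h : α ∈ measuresOfMass a) {z : ℂ} (hz : 0 ≤ z.re) {w : ℂ} (hw : w.re = 0) :
    ∫ s, Complex.exp (-(z * sampleMass a s + w * (sampleMass a s * sampleMean a s : ℝ))) ∂P =
      gammaLaplace α fun x => z + w * x := by
  have := isFiniteMeasure_of_mem_measuresOfMass h
  rw [← hP.integral_exp_neg_integral ha h.1 (IsLaplaceTest.affine h hz hw)]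
  refine integral_congr_ae ?_
  filter_upwards [hP.ae_integral_eq ha h] with s hs
  rw [hs]

/-- Pulling the positive factor `1 + l` out of `1 + l + z + w x` adds the constant `log (1 + l)` to
the logarithm, and `α` has mass `a`. -/
lemma gammaLaplace_affine_scale (ha : 0 < a) (h : α ∈ measuresOfMass a) {l : ℝ} (hl : 0 ≤ l)
    {z w : ℂ} (hz : z.re = 0) (hw : w.re = 0) :
    gammaLaplace α (fun x : ℝ => (l + z) + w * x) =
      Real.exp (-(a * Real.log (1 + l))) *
        gammaLaplace α (fun x : ℝ => z / (1 + l) + w / (1 + l) * x) := by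
  have := isFiniteMeasure_of_mem_measuresOfMass h
  have hl1 : 0 < 1 + l := by linarith
  have hlC : (1 + (l : ℂ)) ≠ 0 := by exact_mod_cast hl1.ne'
  have hre : ∀ {z : ℂ}, z.re = 0 → (z / (1 + l)).re = 0 := fun {z} hz => by
    have : z / (1 + (l : ℂ)) = z / ((1 + l : ℝ) : ℂ) := by push_cast; rfl
    rw [this, Complex.div_ofReal_re, hz, zero_div]
  have ht := IsLaplaceTest.affine h (hre hz).ge (hre hw)
  have hlog : ∀ x : ℝ, Complex.log (1 + (l + z + w * x)) =
      Real.log (1 + l) + Complex.log (1 + (z / (1 + l) + w / (1 + l) * x)) := fun x => by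
    rw [← Complex.log_ofReal_mul hl1 (one_add_ne_zero_of_re_nonneg (ht.re_nonneg x))]
    congr 1
    push_cast
    field_simp
    ring
  simp_rw [gammaLaplace, hlog]
  rw [integral_add (integrable_const _) ht.integrable_log, neg_add, Complex.exp_add, integral_const,
    measureReal_univ_of_eq_ofReal ha h.1]
  simp

/-- The total mass of the gamma random measure is independent of the mean, and its Laplace
transform depends on the total mass of the intensity only. -/
lemma IsGammaSample.integral_exp_neg_mass_mean (hP : IsGammaSample a α P) (ha : 0 < a)
    (h : α ∈ measuresOfMass a) {l : ℝ} (hl : 0 ≤ l) {A : Set ℝ} (hA : MeasurableSet A) :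
    ∫ s in sampleMean a ⁻¹' A, Real.exp (-(l * sampleMass a s)) ∂P =
      Real.exp (-(a * Real.log (1 + l))) * P.real (sampleMean a ⁻¹' A) := by
  have := hP.isProbabilityMeasure
  have hl1 : 0 < 1 + l := by linarith
  have hlC : (1 + (l : ℂ)) ≠ 0 := by exact_mod_cast hl1.ne'
  have hS := measurable_sampleMass (a := a)
  have hM := measurable_sampleMean (a := a)
  set c : ℝ := Real.exp (-(a * Real.log (1 + l))) with hc
  have hdm : Measurable fun s => ENNReal.ofReal (Real.exp (-(l * sampleMass a s))) := by fun_prop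
  set Q : Measure (ℕ → ℝ × ℝ × ℝ) :=
    P.withDensity fun s => ENNReal.ofReal (Real.exp (-(l * sampleMass a s))) with hQ
  have hexp : Integrable (fun s => Real.exp (-(l * sampleMass a s))) P := by
    refine (integrable_const (1 : ℝ)).mono' (by fun_prop) ?_
    filter_upwards [hP.ae_sampleMass_pos ha h] with s hs
    rw [Real.norm_of_nonneg (Real.exp_pos _).le, Real.exp_le_one_iff]
    have := mul_nonneg hl hs.le
    linarith
  have hQfin : IsFiniteMeasure Q := isFiniteMeasure_withDensity_ofReal hexp.2
  have hF1 : Measurable fun s => (sampleMass a s, sampleMass a s * sampleMean a s) := by fun_prop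
  have hF2 : Measurable fun s => ((1 + l)⁻¹ * sampleMass a s,
    (1 + l)⁻¹ * (sampleMass a s * sampleMean a s)) := by fun_prop
  -- Weighting by `exp (-l S)` shifts `z` to `l + z` in the transform of `(S, SM)`, which
  -- `gammaLaplace_affine_scale` converts into a rescaling of the pair by `(1 + l)⁻¹`.
  have hlaw : Q.map (fun s => (sampleMass a s, sampleMass a s * sampleMean a s)) =
      ENNReal.ofReal c • P.map (fun s => ((1 + l)⁻¹ * sampleMass a s,
        (1 + l)⁻¹ * (sampleMass a s * sampleMean a s))) := by
    have : IsFiniteMeasure (ENNReal.ofReal c • P.map (fun s => ((1 + l)⁻¹ * sampleMass a s,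
        (1 + l)⁻¹ * (sampleMass a s * sampleMean a s)))) := Measure.smul_finite _ ENNReal.ofReal_ne_top
    refine Measure.ext_of_charFunDual (funext fun L => ?_)
    have hL : ∀ p : ℝ × ℝ, L p = L (1, 0) * p.1 + L (0, 1) * p.2 := fun p => by
      have : p = p.1 • ((1 : ℝ), (0 : ℝ)) + p.2 • ((0 : ℝ), (1 : ℝ)) := by ext <;> simp
      conv_lhs => rw [this, map_add, map_smul, map_smul]
      simp [mul_comm]
    set z : ℂ := -(L (1, 0) * Complex.I) with hz
    set w : ℂ := -(L (0, 1) * Complex.I) with hw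
    have hzre : z.re = 0 := by simp [hz]
    have hwre : w.re = 0 := by simp [hw]
    have hre : ∀ {z : ℂ}, z.re = 0 → (z / (1 + l)).re = 0 := fun {z} hz => by
      have : z / (1 + (l : ℂ)) = z / ((1 + l : ℝ) : ℂ) := by push_cast; rfl
      rw [this, Complex.div_ofReal_re, hz, zero_div]
    rw [charFunDual_apply, charFunDual_apply, integral_map hF1.aemeasurable (by fun_prop),
      integral_smul_measure, integral_map hF2.aemeasurable (by fun_prop),
      hQ, integral_withDensity_eq_integral_toReal_smul hdm (by simp)]
    have h1 := hP.integral_exp_neg_affine ha h (z := l + z) (by simpa [hzre] using hl) hwre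
    have h2 := hP.integral_exp_neg_affine ha h (hre hzre).ge (hre hwre)
    rw [gammaLaplace_affine_scale ha h hl hzre hwre, ← h2] at h1
    rw [ENNReal.toReal_ofReal (Real.exp_pos _).le, Complex.real_smul]
    refine Eq.trans ?_ (h1.trans ?_)
    · congr with s
      rw [ENNReal.toReal_ofReal (Real.exp_pos _).le, Complex.real_smul, Complex.ofReal_exp,
        ← Complex.exp_add, hL]
      congr 1
      simp only [hz, hw]
      push_cast
      ring
    · congr 2 with s
      rw [hL]
      congr 1
      simp only [hz, hw]
      push_cast
      field_simp
      ring
  -- The identity of laws is tested on a set invariant under rescaling, so the factor `(1 + l)⁻¹`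
  -- disappears and the event becomes `M ∈ A`.
  have hset : MeasurableSet {p : ℝ × ℝ | p.2 / p.1 ∈ A} :=
    (show Measurable fun p : ℝ × ℝ => p.2 / p.1 by fun_prop) hA
  have hval := congrArg (fun μ : Measure (ℝ × ℝ) => μ.real {p : ℝ × ℝ | p.2 / p.1 ∈ A}) hlaw
  simp only [measureReal_ennreal_smul_apply, map_measureReal_apply hF1 hset,
    map_measureReal_apply hF2 hset, ENNReal.toReal_ofReal (Real.exp_pos _).le, hc] at hval
  have hae : ∀ᵐ s ∂P, sampleMass a s * sampleMean a s / sampleMass a s = sampleMean a s := by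
    filter_upwards [hP.ae_sampleMass_pos ha h] with s hs
    field_simp
  have hs2 : P.real ((fun s => ((1 + l)⁻¹ * sampleMass a s,
      (1 + l)⁻¹ * (sampleMass a s * sampleMean a s))) ⁻¹' {p : ℝ × ℝ | p.2 / p.1 ∈ A}) =
      P.real (sampleMean a ⁻¹' A) := by
    refine measureReal_congr ?_
    filter_upwards [hae] with s hs
    refine propext ?_
    change (1 + l)⁻¹ * (sampleMass a s * sampleMean a s) / ((1 + l)⁻¹ * sampleMass a s) ∈ A ↔
      sampleMean a s ∈ A
    rw [mul_div_mul_left _ _ (inv_ne_zero hl1.ne'), hs]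
  have hs1 : Q.real ((fun s => (sampleMass a s, sampleMass a s * sampleMean a s)) ⁻¹'
      {p : ℝ × ℝ | p.2 / p.1 ∈ A}) = Q.real (sampleMean a ⁻¹' A) := by
    refine measureReal_congr ?_
    filter_upwards [(withDensity_absolutelyContinuous P _).ae_le hae] with s hs
    refine propext ?_
    change sampleMass a s * sampleMean a s / sampleMass a s ∈ A ↔ sampleMean a s ∈ A
    rw [hs]
  rw [hs1, hs2] at hval
  rw [← hval, measureReal_def, hQ, withDensity_apply _ (hM hA),
    integral_eq_lintegral_of_nonneg_ae (ae_of_all _ fun s => (Real.exp_pos _).le) (by fun_prop)]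

end DirichletMean

/-! ### The law of the mean determines the parameter. -/

section Injectivity

variable {a : ℝ} {α β : Measure ℝ} {P Q : Measure (ℕ → ℝ × ℝ × ℝ)}

/-- The law of the mean determines the joint law of the mean and the total mass. -/
lemma map_mass_mean_eq (ha : 0 < a) (hα : α ∈ measuresOfMass a) (hβ : β ∈ measuresOfMass a)
    (hP : IsGammaSample a α P) (hQ : IsGammaSample a β Q)
    (hμ : dirichletMeanLaw α = dirichletMeanLaw β) :
    P.map (fun s => (Real.exp (-sampleMass a s), sampleMean a s)) =
      Q.map (fun s => (Real.exp (-sampleMass a s), sampleMean a s)) := by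
  have := hP.isProbabilityMeasure
  have := hQ.isProbabilityMeasure
  have hM := measurable_sampleMean (a := a)
  have hS := measurable_sampleMass (a := a)
  have hY : Measurable fun s => Real.exp (-sampleMass a s) := by fun_prop
  have hmem : ∀ {γ : Measure ℝ} {ρ : Measure (ℕ → ℝ × ℝ × ℝ)}, γ ∈ measuresOfMass a →
      IsGammaSample a γ ρ → ∀ᵐ s ∂ρ, Real.exp (-sampleMass a s) ∈ Icc (0 : ℝ) 1 := fun hγ hR => by
    filter_upwards [hR.ae_sampleMass_pos ha hγ] with s hs
    exact ⟨(Real.exp_pos _).le, by simpa using hs.le⟩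
  refine Measure.ext_prod fun {B A} hB hA => ?_
  -- For fixed `A`, the `n`-th moment of `exp (-S)` over `M ∈ A` is the weighted integral with `l =
  -- n`; it depends only on `a`, `n` and the probability of `M ∈ A`.
  have hmom := map_eq_map_of_forall_integral_pow_eq (μ := P.restrict (sampleMean a ⁻¹' A))
    (ν := Q.restrict (sampleMean a ⁻¹' A)) hY hY (ae_restrict_of_ae (hmem hα hP))
    (ae_restrict_of_ae (hmem hβ hQ)) fun n => by
      simp_rw [← Real.exp_nat_mul, mul_neg]
      rw [hP.integral_exp_neg_mass_mean ha hα n.cast_nonneg hA,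
        hQ.integral_exp_neg_mass_mean ha hβ n.cast_nonneg hA, ← map_measureReal_apply hM hA,
        ← map_measureReal_apply hM hA, hP.map_sampleMean ha hα, hQ.map_sampleMean ha hβ, hμ]
  have h := congrArg (fun μ : Measure ℝ => μ B) hmom
  simp only [Measure.map_apply hY hB, Measure.restrict_apply (hY hB)] at h
  rw [Measure.map_apply (hY.prodMk hM) (hB.prod hA), Measure.map_apply (hY.prodMk hM) (hB.prod hA)]
  exact h

/-- The first moment `SM` of the gamma random measure is a function of `(exp (-S), M)`, namely `-log
(exp (-S)) * M`, and its Fourier transform is the Laplace functional at `w x`. -/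
lemma gammaLaplace_eq_of_dirichletMeanLaw_eq (ha : 0 < a) (hα : α ∈ measuresOfMass a)
    (hβ : β ∈ measuresOfMass a) (hμ : dirichletMeanLaw α = dirichletMeanLaw β) {w : ℂ}
    (hw : w.re = 0) :
    gammaLaplace α (fun x : ℝ => w * x) = gammaLaplace β (fun x : ℝ => w * x) := by
  obtain ⟨P, hP⟩ := exists_isGammaSample ha hα.1
  obtain ⟨Q, hQ⟩ := exists_isGammaSample ha hβ.1
  have hF : Measurable fun s : ℕ → ℝ × ℝ × ℝ => (Real.exp (-sampleMass a s), sampleMean a s) := by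
    have hM := measurable_sampleMean (a := a)
    have hS := measurable_sampleMass (a := a)
    fun_prop
  have hG : Measurable fun p : ℝ × ℝ => Complex.exp (-(w * (-Real.log p.1 * p.2 : ℝ))) := by fun_prop
  have key : ∀ {γ : Measure ℝ} {ρ : Measure (ℕ → ℝ × ℝ × ℝ)}, γ ∈ measuresOfMass a →
      IsGammaSample a γ ρ → gammaLaplace γ (fun x : ℝ => w * x) =
        ∫ p, Complex.exp (-(w * (-Real.log p.1 * p.2 : ℝ)))
          ∂(ρ.map fun s => (Real.exp (-sampleMass a s), sampleMean a s)) := fun {γ ρ} hγ hR => by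
    have h := hR.integral_exp_neg_affine ha hγ (z := 0) le_rfl hw
    simp only [zero_mul, zero_add] at h
    rw [← h, integral_map hF.aemeasurable hG.aestronglyMeasurable]
    simp
  rw [key hα hP, key hβ hQ, map_mass_mean_eq ha hα hβ hP hQ hμ]

/-- Differentiating along a ray and cancelling the nonzero Laplace functional gives a logarithmic
derivative without choosing a branch of its logarithm. -/
lemma integral_inv_one_add_eq (ha : 0 < a) (hα : α ∈ measuresOfMass a) (hβ : β ∈ measuresOfMass a)
    (h : ∀ w : ℂ, w.re = 0 →
      gammaLaplace α (fun x : ℝ => w * x) = gammaLaplace β (fun x : ℝ => w * x))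
    {w : ℂ} (hw : w.re = 0) :
    ∫ x : ℝ, (1 + w * x)⁻¹ ∂α = ∫ x : ℝ, (1 + w * x)⁻¹ ∂β := by
  -- `hasDerivAt_integral_log` needs a parameter inside `(0, 1)`, so the ray through `2 w` is used
  -- at its midpoint `w`.
  have hr : (1 / 2 : ℝ) ∈ Ioo (0 : ℝ) 1 := by norm_num
  have key : ∀ {γ : Measure ℝ}, γ ∈ measuresOfMass a →
      HasDerivAt (fun r : ℝ => gammaLaplace γ fun x : ℝ => (r * (2 * w)) * x)
        (gammaLaplace γ (fun x : ℝ => w * x) * (-(2 * (a - ∫ x : ℝ, (1 + w * x)⁻¹ ∂γ)))) (1 / 2) := by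
    intro γ hγ
    have := isFiniteMeasure_of_mem_measuresOfMass hγ
    have ht : IsLaplaceTest γ fun x : ℝ => 0 + (2 * w) * x :=
      IsLaplaceTest.affine hγ le_rfl (by simp [hw])
    simp only [zero_add] at ht
    have hd := (hasDerivAt_integral_log ht hr).neg.cexp
    have hre : ∀ x : ℝ, 0 ≤ (w * x).re := fun x => by simp [hw]
    have hi : Integrable (fun x : ℝ => (1 + w * x)⁻¹) γ :=
      (integrable_const (1 : ℝ)).mono' (Measurable.aestronglyMeasurable (by fun_prop))
        (ae_of_all _ fun x => norm_inv_one_add_le_one (hre x))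
    have h2 : ∫ x : ℝ, 2 * w * x * (1 + ((1 / 2 : ℝ) : ℂ) * (2 * w * x))⁻¹ ∂γ =
        2 * (a - ∫ x : ℝ, (1 + w * x)⁻¹ ∂γ) := by
      have h3 : ∀ x : ℝ, 2 * w * x * (1 + ((1 / 2 : ℝ) : ℂ) * (2 * w * x))⁻¹ =
          2 * (1 - (1 + w * x)⁻¹) := fun x => by
        have h4 := one_add_ne_zero_of_re_nonneg (hre x)
        have h5 : (1 + ((1 / 2 : ℝ) : ℂ) * (2 * w * x)) = 1 + w * x := by push_cast; ring
        rw [h5]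
        field_simp
        ring
      simp_rw [h3]
      rw [integral_const_mul, integral_sub (integrable_const _) hi, integral_const,
        measureReal_univ_of_eq_ofReal ha hγ.1]
      simp
    rw [h2] at hd
    have hfun : (fun r : ℝ => gammaLaplace γ fun x : ℝ => (r * (2 * w)) * x) =
        fun r : ℝ => Complex.exp ((-fun r : ℝ => ∫ x : ℝ, Complex.log (1 + r * (2 * w * x)) ∂γ) r) := by
      funext r
      simp [gammaLaplace, mul_assoc]
    have hval : gammaLaplace γ (fun x : ℝ => w * x) = Complex.exp
        ((-fun r : ℝ => ∫ x : ℝ, Complex.log (1 + r * (2 * w * x)) ∂γ) (1 / 2)) := by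
      simp only [gammaLaplace, Pi.neg_apply]
      congr 3 with x
      push_cast
      ring_nf
    rw [hfun, hval]
    exact hd
  have hfun : (fun r : ℝ => gammaLaplace α fun x : ℝ => (r * (2 * w)) * x) =
      fun r : ℝ => gammaLaplace β fun x : ℝ => (r * (2 * w)) * x :=
    funext fun r => h _ (by simp [hw])
  have heq := (key hα).unique (hfun ▸ key hβ)
  rw [h w hw] at heq
  have := mul_left_cancel₀ (Complex.exp_ne_zero _) heq
  simpa using this

/-- A measure in `𝔽_a` is determined by the law of the mean of the Dirichlet process. -/
lemma eq_of_dirichletMeanLaw_eq (ha : 0 < a) (hα : α ∈ measuresOfMass a)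
    (hβ : β ∈ measuresOfMass a) (hμ : dirichletMeanLaw α = dirichletMeanLaw β) : α = β := by
  have := isFiniteMeasure_of_mem_measuresOfMass hα
  have := isFiniteMeasure_of_mem_measuresOfMass hβ
  refine ext_of_forall_integral_inv_eq fun t => ?_
  have h := integral_inv_one_add_eq ha hα hβ
    (fun w hw => gammaLaplace_eq_of_dirichletMeanLaw_eq ha hα hβ hμ hw)
    (w := -(t * Complex.I)) (by simp)
  have hx : ∀ x : ℝ, -((t : ℂ) * Complex.I) * x = -(t * x * Complex.I) := fun x => by ring
  simpa only [hx] using h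

end Injectivity

/-- For every parameter in `𝔽_a` the functional Dirichlet distribution exists, is unique, and has
a mean almost surely (so that `μ_α` is well defined); `α ∈ 𝔽_a` is determined by `μ_α`; and
`α ↦ μ_α` is a bijection of `𝔽_a` onto `𝕄_a`. -/
theorem theorem2 (a : ℝ) (ha : 0 < a) :
    (∀ α ∈ measuresOfMass a,
      IsDirichletProcess α (dirichletProcess α) ∧
      (∀ D : Measure (ProbabilityMeasure ℝ),
        IsDirichletProcess α D → D = dirichletProcess α) ∧
      (∀ᵐ (φ : ProbabilityMeasure ℝ) ∂(dirichletProcess α), Integrable (fun x : ℝ => x) (φ : Measure ℝ))) ∧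
    (∀ α₁ ∈ measuresOfMass a, ∀ α₂ ∈ measuresOfMass a,
      dirichletMeanLaw α₁ = dirichletMeanLaw α₂ → α₁ = α₂) ∧
    Set.BijOn dirichletMeanLaw (measuresOfMass a) (dirichletMeanLaws a) := by
  refine ⟨fun α hα => ?_, fun α hα β hβ => eq_of_dirichletMeanLaw_eq ha hα hβ,
    fun α hα => ⟨α, hα, rfl⟩, fun α hα β hβ => eq_of_dirichletMeanLaw_eq ha hα hβ, ?_⟩
  · have h := isDirichletProcess_dirichletProcess ha hα
    exact ⟨h, fun D hD => hD.unique h, ae_integrable_dirichletProcess ha hα⟩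
  · rintro μ ⟨α, hα, rfl⟩
    exact ⟨α, hα, rfl⟩
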